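/- **Setting.** Let $K\ge1$ sensors observe, at times $t=1,2,\dots$, the samples $y_t^k=xh_t^k+w_t^k$, $k=1,\dots,K$, where $x\in\mathbb C$ is an unknown constant with $\Re x\ne0$ and $\Im x\neq 0$ (A1). The noises $w_t^k\sim\mathcal N_c(0,\sigma_k^2)$, $\sigma_k>0$, are circularly symmetric complex Gaussian, independent across $t$ and $k$. The channel gains $h_t^k$ are random and jointly independent of the noises; for each $k$ they are i.i.d. over $t$, with $0<|h_t^k|<\infty$ almost surely (A2) and $\mathsf E|h_t^k|^2<\infty$. Let $\pi$ be the real part or the imaginary part, and put $$U_t^k=\sum_{\tau\le t}\frac{2|h_\tau^k|^2}{\sigma_k^2},\qquad V_t^k=\sum_{\tau\le t}\frac{2\,\pi\big((h_\tau^k)^*y_\tau^k\big)}{\sigma_k^2}.$$ **The estimator LT-sDMLE.** The $r$-bit mid-riser quantizer on an interval $[a,b]$ cuts it into $2^r$ cells of equal length and maps a value to the midpoint of its cell, and a value outside $[a,b]$ to the nearest midpoint. Let $\mathcal I$ be the target Fisher information. Sensor $k$ has the sampling times $t_0^k=0$, $t_n^k=\min\{t>t_{n-1}^k: U_t^k-U_{t_{n-1}^k}^k\ge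 e_k\}$. At time $t_n^k$ it sends to the fusion center $\tilde p_n^k$, the overshoot $p_n^k=U_{t_n^k}^k-U_{t_{n-1}^k}^k-e_k$ quantized with $r_U$ bits on $[0,\theta_k]$. The fusion center forms $\tilde U_t=\sum_k\sum_{n\ge 1:\,t_n^k\le t}(e_k+\tilde p_n^k)$ and stops at $\tilde{\mathcal T}=\min\{t\ge1:\tilde U_t\ge\mathcal I\}$. Then each sensor sends $\tilde V^k$, the value $V^k_{\tilde{\mathcal T}}$ quantized once with $R_k$ bits on $[-\tilde{\mathcal T}\phi_k,\tilde{\mathcal T}\phi_k]$, and the estimate of $\pi(x)$ is $\tilde x_{\tilde{\mathcal T}}=\sum_k\tilde V^k/\tilde U_{\tilde{\mathcal T}}$. Here $e_k=e_k(\mathcal I)$, $R_k=R_k(\mathcal I)$ and $r_U=r_U(\mathcal I)$ may depend on $\mathcal I$ ($r_U$ arbitrarily, for instance not at all), while $\theta_k>0$ and $\phi_k>0$ are constants, with $$\phi_k\ \ge\ |\pi(x)|\;\mathsf E\Big[\frac{2|h_1^k|^2}{\sigma_k^2}\Big].$$ (The condition $\mathsf E|h_t^k|^2<\infty$ is implied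 by the design requirement $\mathsf E|\tilde p_n^k-p_n^k|<\theta_k/2^{r_U+1}$, and the bound on $\phi_k$ is implied, when $R_k\to\infty$, by the design requirement $\mathsf E\big[|\tilde V^k-V^k_{\tilde{\mathcal T}}|\,\big|\,\mathcal H_{\tilde{\mathcal T}}\big]<\tilde{\mathcal T}\phi_k/2^{R_k}$ for all large $\mathcal I$.) Let $\mathcal H_{\tilde{\mathcal T}}$ be the $\sigma$-algebra generated by $\tilde{\mathcal T}$ and the gains $h_\tau^k$, $\tau\le\tilde{\mathcal T}$, $k\le K$. **Theorem.** Suppose that, as $\mathcal I\to\infty$, $R_k\to\infty$ at any rate, $e_k\to\infty$ and $e_k=o(\mathcal I)$, for every $k$. Then, for all sufficiently large $\mathcal I$, $\tilde{\mathcal T}<\infty$ almost surely and $\tilde x_{\tilde{\mathcal T}}$ is integrable, and, as $\mathcal I\to\infty$, LT-sDMLE is, conditionally on the observed channel gains, - asymptotically unbiased: $\mathsf E[\tilde x_{\tilde{\mathcal T}}-\pi(x)\mid\mathcal H_{\tilde{\mathcal T}}]\to0$ almost surely along every sequence $\mathcal I_m\to\infty$; - consistent: for every $\varepsilon>0$,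 $\mathsf P(|\tilde x_{\tilde{\mathcal T}}-\pi(x)|\ge\varepsilon\mid\mathcal H_{\tilde{\mathcal T}})\to0$ almost surely along every sequence $\mathcal I_m\to\infty$; in particular $\tilde x_{\tilde{\mathcal T}}\to\pi(x)$ in probability. -/

import Mathlib

open MeasureTheory ProbabilityTheory Filter Topology
open scoped NNReal ENNReal

noncomputable section

/-- The circularly symmetric complex Gaussian law `N_c(0, v)` on `ℂ`: real and imaginary part are
independent real Gaussian variables with mean `0` and variance `v / 2`. -/
def complexGaussian (v : ℝ≥0) : Measure ℂ :=
  ((gaussianReal 0 (v / 2)).prod (gaussianReal 0 (v / 2))).map Complex.measurableEquivRealProd.symm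

/-- The mid-riser uniform quantizer with `r` bits on the interval `[a, b]`: the interval is cut into
`2 ^ r` cells of equal length, a value in a cell is sent to the midpoint of the cell, and a value
outside `[a, b]` is sent to the nearest midpoint. -/
def midRiser (a b : ℝ) (r : ℕ) (v : ℝ) : ℝ :=
  let Δ : ℝ := (b - a) / 2 ^ r
  let j : ℤ := max 0 (min (2 ^ r - 1) ⌊(v - a) / Δ⌋)
  a + ((j : ℝ) + 1 / 2) * Δ

namespace LTsDMLE

/-! In what follows a sequence `g : ℕ → ℂ` lists the values at the times `1, 2, 3, …`, so that
`g i` is the value at time `i + 1` and `Finset.range t` stands for the times `1, …, t`. -/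

/-- `U_t^k = ∑_{τ ≤ t} 2 |h_τ^k|² / σ_k²`, for one sensor with gains `g` and noise variance `s²`. -/
def info (s : ℝ) (g : ℕ → ℂ) (t : ℕ) : ℝ :=
  ∑ i ∈ Finset.range t, 2 * ‖g i‖ ^ 2 / s ^ 2

/-- `V_t^k = ∑_{τ ≤ t} 2 π((h_τ^k)^* y_τ^k) / σ_k²`, for one sensor with gains `g` and
observations `y`; here `π` is the real part or the imaginary part. -/
def corr (π : ℂ → ℝ) (s : ℝ) (g y : ℕ → ℂ) (t : ℕ) : ℝ :=
  ∑ i ∈ Finset.range t, 2 * π ((starRingEnd ℂ) (g i) * y i) / s ^ 2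

/-- Level-triggered sampling of the process `U` with threshold `e`: `lastSample U e t` is the last
sampling time up to time `t` (time `0` counts as one). The next sampling time is the first
later time at which `U` has grown by at least `e` since the last sampling time. -/
def lastSample (U : ℕ → ℝ) (e : ℝ) : ℕ → ℕ
  | 0 => 0
  | t + 1 => if e ≤ U (t + 1) - U (lastSample U e t) then t + 1 else lastSample U e t

/-- `Ũ_t^k`, the sum of the messages recovered up to time `t` from one sensor: at each sampling time
the increment `u` since the previous sampling time is recovered as `e` plus the overshoot `u - e`
quantized with `r` bits on `[0, θ]`. -/
def recovered (U : ℕ → ℝ) (e θ : ℝ) (r t : ℕ) : ℝ :=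
  ∑ i ∈ Finset.range t,
    if e ≤ U (i + 1) - U (lastSample U e i) then
      e + midRiser 0 θ r (U (i + 1) - U (lastSample U e i) - e)
    else 0

/-- The design parameters of the scheme with `K` sensors: the target information, the thresholds
`e_k`, the range parameters `θ_k` and `φ_k`, and the numbers of bits `r_U` and `R_k`. -/
structure Design (K : ℕ) where
  target : ℝ
  e : Fin K → ℝ
  θ : Fin K → ℝ
  φ : Fin K → ℝ
  rU : ℕ
  R : Fin K → ℕ

variable {K : ℕ}

/-- `Ũ_t = ∑_k Ũ_t^k`, as a function of the noise levels and the gains. -/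
def fusedInfo (D : Design K) (σ : Fin K → ℝ) (g : Fin K → ℕ → ℂ) (t : ℕ) : ℝ :=
  ∑ k, recovered (info (σ k) (g k)) (D.e k) (D.θ k) D.rU t

/-- The stopping time `min {t ≥ 1 : Ũ_t ≥ target}`, which is `⊤` if there is no such `t`. -/
def stopTime (D : Design K) (σ : Fin K → ℝ) (g : Fin K → ℕ → ℂ) : ℕ∞ :=
  ⨅ (t : ℕ) (_ : 1 ≤ t ∧ D.target ≤ fusedInfo D σ g t), (t : ℕ∞)

/-- The estimate at the stopping time `T`: each `V_T^k` is quantized once, with `R_k` bits on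
`[-T φ_k, T φ_k]`, and the sum of the quantized values is divided by `Ũ_T`. -/
def estimate (D : Design K) (π : ℂ → ℝ) (σ : Fin K → ℝ) (g y : Fin K → ℕ → ℂ) : ℝ :=
  let T : ℕ := (stopTime D σ g).toNat
  (∑ k, midRiser (-(T * D.φ k)) (T * D.φ k) (D.R k) (corr π (σ k) (g k) (y k) T)) /
    fusedInfo D σ g T

/-- The channel gains that have been observed up to the stopping time, together with this time:
the gains at later times are replaced by `0`. -/
def observedGains (D : Design K) (σ : Fin K → ℝ) (g : Fin K → ℕ → ℂ) :
    ℕ∞ × (Fin K → ℕ → ℂ) :=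
  (stopTime D σ g, fun k i => if ((i + 1 : ℕ) : ℕ∞) ≤ stopTime D σ g then g k i else 0)

/-- The σ-algebra generated by the channel gains observed up to the stopping time. -/
abbrev gainAlgebra {Ω : Type*} (D : Design K) (σ : Fin K → ℝ) (h : Fin K → ℕ → Ω → ℂ) :
    MeasurableSpace Ω :=
  MeasurableSpace.comap (fun ω => observedGains D σ (fun k i => h k i ω)) inferInstance

/-- The estimate as a random variable: sensor `k` observes `y = x h + w`. -/
def estimator {Ω : Type*} (D : Design K) (π : ℂ → ℝ) (σ : Fin K → ℝ) (x : ℂ)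
    (h w : Fin K → ℕ → Ω → ℂ) (ω : Ω) : ℝ :=
  estimate D π σ (fun k i => h k i ω) (fun k i => x * h k i ω + w k i ω)

end LTsDMLE

end

/-!
The estimate is a function of the channel gains observed up to the stopping time `T` and of the
noise, and the two are independent. Conditioning on the observed gains therefore amounts to freezing
the gains `g` and averaging over the noise (`condExp_estimator`), and the theorem reduces to a
statement about fixed gains: the error averaged over the noise tends to `0` for almost every `g`
(`RegularGains.tendsto_integral_abs_estimate_sub`). Unbiasedness and, by Markov's inequality,
conditional consistency follow; unconditional consistency then follows by dominated convergence.

By the strong law of large numbers, almost every `g` is regular (`RegularGains`): the information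
`U_t` of sensor `k` grows linearly with rate `m_k = E[2 |h|² / σ²]`, and so does, with a rate close
to `m_k`, the information with increments truncated at a large level `M`. For the recovered
information `Ũ` there are two deterministic bounds: `Ũ_t ≤ (1 + θ / e) U_t`, because a message is
worth at most `e + θ` and stands for an increase of at least `e`, and
`∑_{i ≤ t} min (u_i) M ≤ (1 + M / e) Ũ_t + e`, where `u_i` are the increments of `U`, because the
truncated increments between two samples add up to at most `e + M` while the message is worth at
least `e`. As `e → ∞` and `e = o(target) = o(T)`, they squeeze `Ũ_T / T` to the total rate `∑ m_k`,
without any estimate of the overshoots.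

The correlator output is `V_T = π(x) U_T + N_T`, where the noise part has `E|N_T| ≤ √(2 U_T)` for
fixed gains. The quantizer adds an error of at most `T φ / 2 ^ R`, plus the distance of `V_T` to the
range `[-T φ, T φ]`; since `|π(x)| m_k ≤ φ_k`, this distance is at most
`|N_T| + |π(x)| |U_T - T m_k|`. Dividing by `Ũ_T`, which is of order `T`, leaves a vanishing error.

Integrability follows from `|estimate| ≤ T ∑ φ_k / target` and `E T < ∞`. For the latter, while the
scheme runs, the information truncated at `1` is bounded by a constant `C`, an event whose
probability at time `t` is at most `exp C * ρ ^ t` for some `ρ < 1` (`integrable_stopTime`).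
-/

/-! ### The mid-riser quantizer -/

lemma midRiser_index_mem (r : ℕ) (z : ℤ) :
    0 ≤ max 0 (min (2 ^ r - 1) z) ∧ max 0 (min (2 ^ r - 1) z) ≤ 2 ^ r - 1 := by
  have : (1 : ℤ) ≤ 2 ^ r := one_le_pow₀ (by norm_num)
  constructor
  · exact le_max_left _ _
  · exact max_le (by linarith) (min_le_left _ _)

lemma midRiser_mem_Icc {a b : ℝ} (hab : a ≤ b) (r : ℕ) (v : ℝ) :
    midRiser a b r v ∈ Set.Icc a b := by
  obtain ⟨h0, h1⟩ := midRiser_index_mem r ⌊(v - a) / ((b - a) / 2 ^ r)⌋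
  have h0' : (0 : ℝ) ≤ ((max 0 (min (2 ^ r - 1) ⌊(v - a) / ((b - a) / 2 ^ r)⌋) : ℤ) : ℝ) := by
    exact_mod_cast h0
  have h1' : ((max 0 (min (2 ^ r - 1) ⌊(v - a) / ((b - a) / 2 ^ r)⌋) : ℤ) : ℝ) ≤ 2 ^ r - 1 := by
    exact_mod_cast h1
  have hpos : (0 : ℝ) < 2 ^ r := by positivity
  have hΔ : 0 ≤ (b - a) / 2 ^ r := div_nonneg (by linarith) hpos.le
  have hmul : 2 ^ r * ((b - a) / 2 ^ r) = b - a := by field_simp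
  unfold midRiser
  dsimp only
  constructor <;> nlinarith

/-- The quantization error is at most half a cell, plus the distance to the interval for a value
outside of it. -/
lemma abs_midRiser_sub_le {c : ℝ} (hc : 0 < c) (r : ℕ) (v : ℝ) :
    |midRiser (-c) c r v - v| ≤ c / 2 ^ r + max 0 (|v| - c) := by
  have hpos : (0 : ℝ) < 2 ^ r := by positivity
  have hone : (1 : ℤ) ≤ 2 ^ r := one_le_pow₀ (by norm_num)
  set Δ : ℝ := (c - -c) / 2 ^ r with hΔ
  have hΔ0 : 0 < Δ := div_pos (by linarith) hpos
  have hmul : 2 ^ r * Δ = 2 * c := by rw [hΔ]; field_simp; ring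
  have hhalf : c / 2 ^ r = Δ / 2 := by rw [hΔ]; ring
  rw [hhalf]
  have hfl := Int.floor_le ((v - -c) / Δ)
  have hlt := Int.lt_floor_add_one ((v - -c) / Δ)
  rw [le_div_iff₀ hΔ0] at hfl
  rw [div_lt_iff₀ hΔ0] at hlt
  have hm0 := le_max_left 0 (|v| - c)
  have hm1 := le_max_right 0 (|v| - c)
  have hv1 := le_abs_self v
  have hv2 := neg_abs_le v
  unfold midRiser
  simp only [← hΔ]
  generalize ⌊(v - -c) / Δ⌋ = z at *
  rcases lt_or_ge z 0 with hz | hz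
  · have : max 0 (min (2 ^ r - 1) z) = 0 := max_eq_left ((min_le_right _ _).trans hz.le)
    rw [this]
    have hz' : (z : ℝ) + 1 ≤ 0 := by exact_mod_cast hz
    have : v + c ≤ 0 := by nlinarith
    rw [abs_le]
    push_cast
    constructor <;> linarith
  rcases le_or_gt z (2 ^ r - 1) with hz' | hz'
  · rw [min_eq_right hz', max_eq_right hz, abs_le]
    constructor <;> linarith
  · rw [min_eq_left hz'.le, max_eq_right (by linarith)]
    have hz'' : (2 : ℝ) ^ r ≤ z := by
      have : (2 : ℤ) ^ r ≤ z := by linarith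
      exact_mod_cast this
    have : 2 * c ≤ v + c := by nlinarith
    push_cast
    rw [abs_le]
    constructor <;> nlinarith

lemma measurable_midRiser (a b : ℝ) (r : ℕ) : Measurable (midRiser a b r) := by
  unfold midRiser
  have : Measurable fun v : ℝ =>
      (((max 0 (min (2 ^ r - 1) ⌊(v - a) / ((b - a) / 2 ^ r)⌋) : ℤ)) : ℝ) :=
    (measurable_from_top (f := fun z : ℤ => ((max 0 (min (2 ^ r - 1) z) : ℤ) : ℝ))).comp
      (Int.measurable_floor.comp (by fun_prop))
  exact ((this.add_const _).mul_const _).const_add _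

namespace LTsDMLE

/-! ### Level-triggered sampling -/

section Sampling

variable {U : ℕ → ℝ} {e θ : ℝ}

lemma sub_lastSample_lt (he : 0 < e) (t : ℕ) : U t - U (lastSample U e t) < e := by
  cases t with
  | zero => simpa [lastSample] using he
  | succ t =>
    unfold lastSample
    split_ifs with h
    · simpa using he
    · exact not_le.1 h

lemma lastSample_le (t : ℕ) : lastSample U e t ≤ t := by
  cases t with
  | zero => simp [lastSample]
  | succ t =>
    unfold lastSample
    split_ifs with h
    · exact le_rfl
    · exact (lastSample_le t).trans (Nat.le_succ t)

lemma recovered_succ (r t : ℕ) : recovered U e θ r (t + 1) = recovered U e θ r t +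
    if e ≤ U (t + 1) - U (lastSample U e t) then
      e + midRiser 0 θ r (U (t + 1) - U (lastSample U e t) - e) else 0 := by
  simp [recovered, Finset.sum_range_succ]

/-- Each message is worth at most `e + θ`, while the information has grown by at least `e`. -/
lemma recovered_le (he : 0 < e) (hθ : 0 ≤ θ) (hU : Monotone U) (hU0 : U 0 = 0) (r t : ℕ) :
    recovered U e θ r t ≤ (1 + θ / e) * U t := by
  have hfac : 0 ≤ 1 + θ / e := by positivity
  suffices recovered U e θ r t ≤ (1 + θ / e) * U (lastSample U e t) from
    this.trans (mul_le_mul_of_nonneg_left (hU (lastSample_le t)) hfac)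
  induction t with
  | zero => simp [recovered, lastSample, hU0]
  | succ t ih =>
    rw [recovered_succ]
    simp only [lastSample]
    split_ifs with h
    · have hq := (midRiser_mem_Icc hθ r (U (t + 1) - U (lastSample U e t) - e)).2
      have h1 : (1 + θ / e) * e ≤ (1 + θ / e) * (U (t + 1) - U (lastSample U e t)) :=
        mul_le_mul_of_nonneg_left h hfac
      have h2 : (1 + θ / e) * e = e + θ := by field_simp
      linarith
    · simpa using ih

/-- Between two consecutive samples the increments truncated at `M` add up to at most `e + M`, and
the message is worth at least `e`. Truncation makes any control of the overshoots superfluous. -/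
lemma sum_min_le_recovered {a : ℕ → ℝ} {M : ℝ} (he : 0 < e) (hθ : 0 ≤ θ) (hM : 0 ≤ M)
    (hU : ∀ t, U t = ∑ i ∈ Finset.range t, a i) (r t : ℕ) :
    ∑ i ∈ Finset.range t, min (a i) M ≤ (1 + M / e) * recovered U e θ r t + e := by
  suffices ∑ i ∈ Finset.range t, min (a i) M ≤
      (1 + M / e) * recovered U e θ r t + (U t - U (lastSample U e t)) from
    this.trans (by linarith [sub_lastSample_lt (U := U) he t])
  induction t with
  | zero => simp [recovered, lastSample]
  | succ t ih =>
    have hlt := sub_lastSample_lt (U := U) he t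
    have hUt : U (t + 1) = U t + a t := by rw [hU, hU, Finset.sum_range_succ]
    rw [recovered_succ, Finset.sum_range_succ]
    simp only [lastSample]
    split_ifs with h
    · have hq := (midRiser_mem_Icc hθ r (U (t + 1) - U (lastSample U e t) - e)).1
      have hM' := min_le_right (a t) M
      have h2 : (1 + M / e) * e = e + M := by field_simp
      have h3 : 0 ≤ (1 + M / e) * midRiser 0 θ r (U (t + 1) - U (lastSample U e t) - e) := by
        positivity
      nlinarith
    · have hM' := min_le_left (a t) M
      linarith

lemma recovered_nonneg (he : 0 < e) (hθ : 0 ≤ θ) (r t : ℕ) : 0 ≤ recovered U e θ r t := by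
  refine Finset.sum_nonneg fun i _ => ?_
  split_ifs
  · exact add_nonneg he.le (midRiser_mem_Icc hθ r _).1
  · exact le_rfl

end Sampling

/-! ### The stopping time and measurability -/

section StopTime

variable {K : ℕ} {D : Design K} {σ : Fin K → ℝ} {g : Fin K → ℕ → ℂ}

lemma stopTime_le {t : ℕ} (ht : 1 ≤ t) (h : D.target ≤ fusedInfo D σ g t) :
    stopTime D σ g ≤ t := iInf₂_le t ⟨ht, h⟩

lemma stopTime_spec (h : stopTime D σ g ≠ ⊤) :
    1 ≤ (stopTime D σ g).toNat ∧ D.target ≤ fusedInfo D σ g (stopTime D σ g).toNat := by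
  set S : Set ℕ∞ := (fun t : ℕ => (t : ℕ∞)) '' {t | 1 ≤ t ∧ D.target ≤ fusedInfo D σ g t} with hS
  have hst : stopTime D σ g = sInf S := by rw [hS, sInf_image]; rfl
  have hne : S.Nonempty := by
    rw [Set.nonempty_iff_ne_empty]
    intro he
    rw [hst, he, sInf_empty] at h
    exact h rfl
  obtain ⟨t, ht, hts⟩ := csInf_mem hne
  have : (stopTime D σ g).toNat = t := by
    rw [hst, ← hts]; simp
  rw [this]
  exact ht

lemma measurable_eval_nat {α : Type*} [MeasurableSpace α] {f : α → ℕ → ℝ} {N : α → ℕ}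
    (hf : ∀ t, Measurable fun x => f x t) (hN : Measurable N) : Measurable fun x => f x (N x) :=
  (measurable_from_prod_countable_left (f := fun p : α × ℕ => f p.1 p.2) hf).comp
    (measurable_id.prodMk hN)

lemma measurable_info (s : ℝ) (t : ℕ) : Measurable fun g : ℕ → ℂ => info s g t := by
  unfold info
  fun_prop

lemma measurable_info_lastSample (s e : ℝ) (t : ℕ) :
    Measurable fun g : ℕ → ℂ => info s g (lastSample (info s g) e t) := by
  have hcomp : ∀ N : (ℕ → ℂ) → ℕ, Measurable N → Measurable fun g => info s g (N g) :=
    fun _ hN => measurable_eval_nat (measurable_info s) hN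
  suffices Measurable fun g : ℕ → ℂ => lastSample (info s g) e t from hcomp _ this
  induction t with
  | zero => exact measurable_const
  | succ t ih =>
    have hset : MeasurableSet
        {g : ℕ → ℂ | e ≤ info s g (t + 1) - info s g (lastSample (info s g) e t)} :=
      measurableSet_le measurable_const ((measurable_info s (t + 1)).sub (hcomp _ ih))
    simp only [lastSample]
    exact Measurable.ite hset measurable_const ih

lemma measurable_fusedInfo (D : Design K) (σ : Fin K → ℝ) (t : ℕ) :
    Measurable fun g : Fin K → ℕ → ℂ => fusedInfo D σ g t := by
  unfold fusedInfo recovered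
  refine Finset.measurable_sum _ fun k _ => Finset.measurable_sum _ fun i _ => ?_
  have h : Measurable fun g : Fin K → ℕ → ℂ =>
      info (σ k) (g k) (i + 1) - info (σ k) (g k) (lastSample (info (σ k) (g k)) (D.e k) i) :=
    ((measurable_info (σ k) (i + 1)).sub (measurable_info_lastSample (σ k) (D.e k) i)).comp
      (measurable_pi_apply k)
  exact Measurable.ite (measurableSet_le measurable_const h)
    (((measurable_midRiser _ _ _).comp (h.sub_const _)).const_add _) measurable_const

lemma measurable_stopTime (D : Design K) (σ : Fin K → ℝ) :
    Measurable fun g : Fin K → ℕ → ℂ => stopTime D σ g := by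
  have : BorelSpace ℕ∞ := ⟨borel_eq_top_of_countable.symm⟩
  unfold stopTime
  refine Measurable.iInf fun t => ?_
  classical
  have : (fun g : Fin K → ℕ → ℂ => ⨅ (_ : 1 ≤ t ∧ D.target ≤ fusedInfo D σ g t), (t : ℕ∞)) =
      fun g => if 1 ≤ t ∧ D.target ≤ fusedInfo D σ g t then (t : ℕ∞) else ⊤ := by
    funext g
    exact iInf_eq_if _
  rw [this]
  refine Measurable.ite ?_ measurable_const measurable_const
  exact (MeasurableSet.const _).inter
    (measurableSet_le measurable_const (measurable_fusedInfo D σ t))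

lemma measurable_observedGains (D : Design K) (σ : Fin K → ℝ) :
    Measurable (observedGains D σ) := by
  refine (measurable_stopTime D σ).prodMk ?_
  refine measurable_pi_lambda _ fun k => measurable_pi_lambda _ fun i => ?_
  exact Measurable.ite ((measurable_stopTime D σ) (MeasurableSet.of_discrete (s := Set.Ici _)))
    (by fun_prop) measurable_const

end StopTime

/-! ### Regular gains: the recovered information at the stopping time -/

section Asymptotics

variable {K : ℕ}

/-- The typical behaviour of the gains: the information of sensor `k` grows linearly with rate
`m k`, and so does, with a rate as close to `m k` as desired, the information truncated at a
suitable level. -/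
def RegularGains (σ m : Fin K → ℝ) (g : Fin K → ℕ → ℂ) : Prop :=
  ∀ k, Tendsto (fun t : ℕ => info (σ k) (g k) t / t) atTop (𝓝 (m k)) ∧
    ∀ a < m k, ∃ M : ℝ, 0 ≤ M ∧
      ∀ᶠ t : ℕ in atTop, a * t ≤ ∑ i ∈ Finset.range t, min (2 * ‖g k i‖ ^ 2 / σ k ^ 2) M

/-- The family of designs indexed by the target information. -/
def scheme (e : Fin K → ℝ → ℝ) (θ φ : Fin K → ℝ) (rU : ℝ → ℕ) (R : Fin K → ℝ → ℕ) (I : ℝ) :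
    Design K :=
  ⟨I, fun k => e k I, θ, φ, rU I, fun k => R k I⟩

lemma info_zero (s : ℝ) (g : ℕ → ℂ) : info s g 0 = 0 := by simp [info]

lemma monotone_info (s : ℝ) (g : ℕ → ℂ) : Monotone (info s g) :=
  monotone_nat_of_le_succ fun t => by
    simp only [info, Finset.sum_range_succ]
    have : 0 ≤ 2 * ‖g t‖ ^ 2 / s ^ 2 := by positivity
    linarith

lemma info_nonneg (s : ℝ) (g : ℕ → ℂ) (t : ℕ) : 0 ≤ info s g t :=
  (info_zero s g).symm.le.trans (monotone_info s g (Nat.zero_le t))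

variable {σ m : Fin K → ℝ} {g : Fin K → ℕ → ℂ}

lemma RegularGains.stopTime_ne_top (hg : RegularGains σ m g) (hm : ∀ k, 0 < m k) (hK : 0 < K)
    {D : Design K} (he : ∀ k, 0 < D.e k) (hθ : ∀ k, 0 < D.θ k) : stopTime D σ g ≠ ⊤ := by
  set k : Fin K := ⟨0, hK⟩
  obtain ⟨M, hM, hev⟩ := (hg k).2 (m k / 2) (by linarith [hm k])
  have hfac : 0 < 1 + M / D.e k := by have := he k; positivity
  have hlin : Tendsto (fun t : ℕ => m k / 2 * (t : ℝ)) atTop atTop :=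
    tendsto_natCast_atTop_atTop.const_mul_atTop (by linarith [hm k])
  obtain ⟨t, h1, h2, ht⟩ := (hev.and ((hlin.eventually_ge_atTop
    ((1 + M / D.e k) * D.target + D.e k)).and (eventually_ge_atTop 1))).exists
  have h3 := sum_min_le_recovered (he k) (hθ k).le hM
    (U := info (σ k) (g k)) (fun _ => rfl) D.rU t
  have h4 : D.target ≤ recovered (info (σ k) (g k)) (D.e k) (D.θ k) D.rU t :=
    le_of_mul_le_mul_left (by linarith) hfac
  have h5 : D.target ≤ fusedInfo D σ g t := h4.trans
    (Finset.single_le_sum (f := fun k => recovered (info (σ k) (g k)) (D.e k) (D.θ k) D.rU t)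
      (fun k _ => recovered_nonneg (he k) (hθ k).le _ _) (Finset.mem_univ k))
  exact ne_top_of_le_ne_top (ENat.natCast_ne_top t) (stopTime_le ht h5)

variable {e : Fin K → ℝ → ℝ} {θ φ : Fin K → ℝ} {rU : ℝ → ℕ} {R : Fin K → ℝ → ℕ}

lemma RegularGains.eventually_stopTime_ne_top (hg : RegularGains σ m g) (hm : ∀ k, 0 < m k)
    (hK : 0 < K) (hθ : ∀ k, 0 < θ k) (he : ∀ k, Tendsto (e k) atTop atTop) :
    ∀ᶠ I in atTop, stopTime (scheme e θ φ rU R I) σ g ≠ ⊤ := by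
  filter_upwards [eventually_all.2 fun k => (he k).eventually_gt_atTop 0] with I hI
  exact hg.stopTime_ne_top hm hK hI hθ

/-- When the scheme stops, the target is at most a constant multiple of the true information. -/
lemma RegularGains.eventually_target_le (hg : RegularGains σ m g) (hm : ∀ k, 0 < m k)
    (hK : 0 < K) (hθ : ∀ k, 0 < θ k) (he : ∀ k, Tendsto (e k) atTop atTop) :
    ∀ᶠ I in atTop, I ≤ ∑ k, (1 + θ k) *
      info (σ k) (g k) (stopTime (scheme e θ φ rU R I) σ g).toNat := by
  filter_upwards [eventually_all.2 fun k => (he k).eventually_ge_atTop 1,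
    hg.eventually_stopTime_ne_top (φ := φ) (rU := rU) (R := R) hm hK hθ he] with I hI htop
  refine (stopTime_spec htop).2.trans (Finset.sum_le_sum fun k _ => ?_)
  refine (recovered_le (zero_lt_one.trans_le (hI k)) (hθ k).le (monotone_info _ _)
    (info_zero _ _) _ _).trans ?_
  have : θ k / e k I ≤ θ k := div_le_self (hθ k).le (hI k)
  exact mul_le_mul_of_nonneg_right (by simpa [scheme] using this) (info_nonneg _ _ _)

lemma RegularGains.tendsto_stopTime (hg : RegularGains σ m g) (hm : ∀ k, 0 < m k)
    (hK : 0 < K) (hθ : ∀ k, 0 < θ k) (he : ∀ k, Tendsto (e k) atTop atTop) :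
    Tendsto (fun I => (stopTime (scheme e θ φ rU R I) σ g).toNat) atTop atTop := by
  refine tendsto_atTop.2 fun N => ?_
  filter_upwards [hg.eventually_target_le (φ := φ) (rU := rU) (R := R) hm hK hθ he,
    eventually_gt_atTop (∑ k, (1 + θ k) * info (σ k) (g k) N)] with I h1 h2
  by_contra! hlt
  refine absurd (h1.trans (Finset.sum_le_sum fun k _ => ?_)) (not_le.2 h2)
  have := hθ k
  exact mul_le_mul_of_nonneg_left (monotone_info _ _ hlt.le) (by positivity)

lemma RegularGains.tendsto_threshold_div (hg : RegularGains σ m g) (hm : ∀ k, 0 < m k)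
    (hK : 0 < K) (hθ : ∀ k, 0 < θ k) (he : ∀ k, Tendsto (e k) atTop atTop)
    (he' : ∀ k, (e k) =o[atTop] (fun I : ℝ => I)) (k : Fin K) :
    Tendsto (fun I => e k I / (stopTime (scheme e θ φ rU R I) σ g).toNat) atTop (𝓝 0) := by
  have hT := hg.tendsto_stopTime (φ := φ) (rU := rU) (R := R) hm hK hθ he
  have hlim : Tendsto (fun t : ℕ => ∑ k, (1 + θ k) * (info (σ k) (g k) t / t)) atTop
      (𝓝 (∑ k, (1 + θ k) * m k)) :=
    tendsto_finsetSum _ fun k _ => (hg k).1.const_mul _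
  have hbound := (he' k).tendsto_div_nhds_zero.mul (hlim.comp hT)
  rw [zero_mul] at hbound
  refine squeeze_zero' ?_ ?_ hbound
  · filter_upwards [(he k).eventually_ge_atTop 0] with I hI
    positivity
  · filter_upwards [(he k).eventually_ge_atTop 0, eventually_gt_atTop 0,
      hT.eventually_gt_atTop 0,
      hg.eventually_target_le (φ := φ) (rU := rU) (R := R) hm hK hθ he] with I h0 hI hTI hle
    have hTpos : (0 : ℝ) < (stopTime (scheme e θ φ rU R I) σ g).toNat := by exact_mod_cast hTI
    have h1 : ∑ k, (1 + θ k) * (info (σ k) (g k) (stopTime (scheme e θ φ rU R I) σ g).toNat /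
        (stopTime (scheme e θ φ rU R I) σ g).toNat) =
        (∑ k, (1 + θ k) * info (σ k) (g k) (stopTime (scheme e θ φ rU R I) σ g).toNat) /
        (stopTime (scheme e θ φ rU R I) σ g).toNat := by
      rw [Finset.sum_div]
      exact Finset.sum_congr rfl fun _ _ => by ring
    simp only [Function.comp]
    rw [h1, div_mul_div_comm, div_le_div_iff₀ hTpos (by positivity)]
    have := mul_le_mul_of_nonneg_left hle (mul_nonneg h0 hTpos.le)
    linarith

/-- At the stopping time the information recovered by the fusion center is asymptotically equal to
the true one. -/
lemma RegularGains.tendsto_fusedInfo_div (hg : RegularGains σ m g) (hm : ∀ k, 0 < m k)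
    (hK : 0 < K) (hθ : ∀ k, 0 < θ k) (he : ∀ k, Tendsto (e k) atTop atTop)
    (he' : ∀ k, (e k) =o[atTop] (fun I : ℝ => I)) :
    Tendsto (fun I => fusedInfo (scheme e θ φ rU R I) σ g
      (stopTime (scheme e θ φ rU R I) σ g).toNat / (stopTime (scheme e θ φ rU R I) σ g).toNat)
      atTop (𝓝 (∑ k, m k)) := by
  have hT := hg.tendsto_stopTime (φ := φ) (rU := rU) (R := R) hm hK hθ he
  have heT := hg.tendsto_threshold_div (φ := φ) (rU := rU) (R := R) hm hK hθ he he'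
  simp only [fusedInfo, Finset.sum_div]
  refine tendsto_finsetSum _ fun k _ => ?_
  set T : ℝ → ℕ := fun I => (stopTime (scheme e θ φ rU R I) σ g).toNat with hTdef
  have hone : ∀ c : ℝ, Tendsto (fun I => 1 + c / e k I) atTop (𝓝 1) := fun c => by
    simpa using ((he k).const_div_atTop c).const_add 1
  refine tendsto_order.2 ⟨fun a ha => ?_, fun a ha => ?_⟩
  · obtain ⟨b, hab, hbm⟩ := exists_between ha
    obtain ⟨M, hM, hev⟩ := (hg k).2 b hbm
    have hlow : Tendsto (fun I => (b - e k I / T I) / (1 + M / e k I)) atTop (𝓝 b) := by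
      have := ((heT k).const_sub b).div (hone M) one_ne_zero
      rwa [sub_zero, div_one] at this
    filter_upwards [hlow.eventually_const_lt hab, hT.eventually hev,
      (he k).eventually_gt_atTop 0, hT.eventually_gt_atTop 0] with I h1 h2 h3 h4
    have hTpos : (0 : ℝ) < T I := by exact_mod_cast h4
    refine h1.trans_le ?_
    have hfac : 0 < 1 + M / e k I := by positivity
    have h5 := sum_min_le_recovered h3 (hθ k).le hM
      (U := info (σ k) (g k)) (fun _ => rfl) (rU I) (T I)
    rw [div_le_div_iff₀ hfac hTpos, sub_mul, div_mul_cancel₀ _ hTpos.ne']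
    have h6 : b * (T I : ℝ) ≤ _ := h2.trans h5
    change b * (T I : ℝ) - e k I ≤
      recovered (info (σ k) (g k)) (e k I) (θ k) (rU I) (T I) * (1 + M / e k I)
    linarith
  · have hup : Tendsto (fun I => (1 + θ k / e k I) * (info (σ k) (g k) (T I) / T I)) atTop
        (𝓝 (m k)) := by
      simpa using (hone (θ k)).mul ((hg k).1.comp hT)
    filter_upwards [hup.eventually_lt_const ha, (he k).eventually_gt_atTop 0] with I h1 h3
    refine lt_of_le_of_lt ?_ h1
    rw [← mul_div_assoc]
    exact div_le_div_of_nonneg_right (recovered_le h3 (hθ k).le (monotone_info _ _)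
      (info_zero _ _) _ _) (Nat.cast_nonneg _)

end Asymptotics

/-! ### The noise at the output of the correlators -/

section Noise

variable {Ω : Type*} [MeasurableSpace Ω] {μ : Measure Ω} {π : ℂ → ℝ}

lemma measurable_part (hπ : π = Complex.re ∨ π = Complex.im) : Measurable π := by
  rcases hπ with rfl | rfl
  · exact Complex.measurable_re
  · exact Complex.measurable_im

lemma abs_part_le (hπ : π = Complex.re ∨ π = Complex.im) (z : ℂ) : |π z| ≤ ‖z‖ := by
  rcases hπ with rfl | rfl
  · exact Complex.abs_re_le_norm z
  · exact Complex.abs_im_le_norm z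

/-- The correlator output is the signal `π x` times the information, plus the correlator output of
the noise alone. -/
lemma corr_add (hπ : π = Complex.re ∨ π = Complex.im) (s : ℝ) (x : ℂ) (g w : ℕ → ℂ) (t : ℕ) :
    corr π s g (fun i => x * g i + w i) t = π x * info s g t + corr π s g w t := by
  unfold corr info
  rw [Finset.mul_sum, ← Finset.sum_add_distrib]
  refine Finset.sum_congr rfl fun i _ => ?_
  have hn : ‖g i‖ ^ 2 = (g i).re * (g i).re + (g i).im * (g i).im := by
    rw [← Complex.normSq_eq_norm_sq, Complex.normSq_apply]
  rw [hn]
  rcases hπ with rfl | rfl <;> simp <;> ring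

lemma map_re_complexGaussian (v : ℝ≥0) :
    (complexGaussian v).map Complex.re = gaussianReal 0 (v / 2) := by
  unfold complexGaussian
  rw [Measure.map_map Complex.measurable_re (MeasurableEquiv.measurable _)]
  change Measure.map Prod.fst _ = _
  rw [Measure.map_fst_prod]
  simp

lemma map_im_complexGaussian (v : ℝ≥0) :
    (complexGaussian v).map Complex.im = gaussianReal 0 (v / 2) := by
  unfold complexGaussian
  rw [Measure.map_map Complex.measurable_im (MeasurableEquiv.measurable _)]
  change Measure.map Prod.snd _ = _
  rw [Measure.map_snd_prod]
  simp

lemma moments_of_map_eq_gaussianReal {X : Ω → ℝ} (hX : Measurable X) {v : ℝ≥0}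
    (hlaw : μ.map X = gaussianReal 0 v) :
    MemLp X 2 μ ∧ ∫ ω, X ω ∂μ = 0 ∧ ∫ ω, X ω ^ 2 ∂μ = v := by
  have h2 : MemLp X 2 μ := by
    have := memLp_id_gaussianReal (μ := 0) (v := v) 2
    rw [← hlaw] at this
    exact (memLp_map_measure_iff (by fun_prop) hX.aemeasurable).1 this
  have h1 : ∫ ω, X ω ∂μ = 0 := by
    have := integral_id_gaussianReal (μ := 0) (v := v)
    rwa [← hlaw, integral_map hX.aemeasurable (by fun_prop)] at this
  refine ⟨h2, h1, ?_⟩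
  have := variance_id_gaussianReal (μ := 0) (v := v)
  rw [← hlaw, variance_map (by fun_prop) hX.aemeasurable] at this
  rw [← this, Function.id_comp, variance_of_integral_eq_zero hX.aemeasurable h1]

variable [IsProbabilityMeasure μ]

/-- For fixed gains, the noise at the output of the correlator is of the order of the square root
of the information. -/
lemma integral_abs_corr_noise_le (hπ : π = Complex.re ∨ π = Complex.im) {s : ℝ≥0}
    {w : ℕ → Ω → ℂ} (hw : ∀ i, Measurable (w i))
    (hlaw : ∀ i, μ.map (w i) = complexGaussian (s ^ 2))
    (hind : Pairwise fun i j => w i ⟂ᵢ[μ] w j) (g : ℕ → ℂ) (t : ℕ) :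
    Integrable (fun ω => corr π s g (fun i => w i ω) t) μ ∧
      ∫ ω, |corr π s g (fun i => w i ω) t| ∂μ ≤ √(2 * info s g t) := by
  set X : ℕ → Ω → ℝ := fun i ω => 2 * π ((starRingEnd ℂ) (g i) * w i ω) / (s : ℝ) ^ 2 with hX
  have hre : ∀ i, MemLp (fun ω => (w i ω).re) 2 μ ∧ ∫ ω, (w i ω).re ∂μ = 0 ∧
      ∫ ω, (w i ω).re ^ 2 ∂μ = ((s ^ 2 / 2 : ℝ≥0) : ℝ) := fun i => moments_of_map_eq_gaussianReal (μ := μ) (v := s ^ 2 / 2)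
    (Complex.measurable_re.comp (hw i)) (by
      rw [← Measure.map_map Complex.measurable_re (hw i), hlaw, map_re_complexGaussian])
  have him : ∀ i, MemLp (fun ω => (w i ω).im) 2 μ ∧ ∫ ω, (w i ω).im ∂μ = 0 ∧
      ∫ ω, (w i ω).im ^ 2 ∂μ = ((s ^ 2 / 2 : ℝ≥0) : ℝ) := fun i => moments_of_map_eq_gaussianReal (μ := μ) (v := s ^ 2 / 2)
    (Complex.measurable_im.comp (hw i)) (by
      rw [← Measure.map_map Complex.measurable_im (hw i), hlaw, map_im_complexGaussian])
  have hpart : Measurable π := measurable_part hπ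
  have hXmeas : ∀ i, Measurable (X i) := fun i =>
    ((hpart.comp ((hw i).const_mul _)).const_mul 2).div_const _
  -- each term is a linear combination of the real and the imaginary part of the noise
  have hlin : ∀ i, ∃ a b : ℝ, X i = fun ω => a * (w i ω).re + b * (w i ω).im := by
    intro i
    rcases hπ with rfl | rfl
    · refine ⟨2 * (g i).re / s ^ 2, 2 * (g i).im / s ^ 2, funext fun ω => ?_⟩
      simp [hX]; ring
    · refine ⟨-(2 * (g i).im / s ^ 2), 2 * (g i).re / s ^ 2, funext fun ω => ?_⟩
      simp [hX]; ring
  have hLp : ∀ i, MemLp (X i) 2 μ := by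
    intro i
    obtain ⟨a, b, hab⟩ := hlin i
    rw [hab]
    exact ((hre i).1.const_mul a).add ((him i).1.const_mul b)
  have hmean : ∀ i, ∫ ω, X i ω ∂μ = 0 := by
    intro i
    obtain ⟨a, b, hab⟩ := hlin i
    have h1 := (hre i).2.1
    have h2 := (him i).2.1
    simp only [hab]
    rw [integral_add (((hre i).1.integrable (by norm_num)).const_mul a)
      (((him i).1.integrable (by norm_num)).const_mul b), integral_const_mul, integral_const_mul,
      h1, h2]
    simp
  -- the true variance is half of this bound; the cruder `|π z| ≤ ‖z‖` needs no correlation between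
  -- the real and the imaginary part of the noise
  have hvar : ∀ i, Var[X i; μ] ≤ 2 * (2 * ‖g i‖ ^ 2 / (s : ℝ) ^ 2) := by
    intro i
    have h1 := (hre i).2.2
    have h2 := (him i).2.2
    have hi1 := (hre i).1.integrable_sq
    have hi2 := (him i).1.integrable_sq
    rw [variance_of_integral_eq_zero (hXmeas i).aemeasurable (hmean i)]
    have hle : ∀ ω, X i ω ^ 2 ≤
        (2 * ‖g i‖ / (s : ℝ) ^ 2) ^ 2 * ((w i ω).re ^ 2 + (w i ω).im ^ 2) := by
      intro ω
      have h3 : |π ((starRingEnd ℂ) (g i) * w i ω)| ≤ ‖g i‖ * ‖w i ω‖ :=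
        (abs_part_le hπ _).trans (by simp)
      have h4 : ‖w i ω‖ ^ 2 = (w i ω).re ^ 2 + (w i ω).im ^ 2 := by
        rw [← Complex.normSq_eq_norm_sq, Complex.normSq_apply]; ring
      rw [← h4]
      have h5 := pow_le_pow_left₀ (abs_nonneg _) h3 2
      rw [sq_abs] at h5
      calc X i ω ^ 2 = (2 / (s : ℝ) ^ 2) ^ 2 * π ((starRingEnd ℂ) (g i) * w i ω) ^ 2 := by
            simp only [hX]; ring
        _ ≤ (2 / (s : ℝ) ^ 2) ^ 2 * (‖g i‖ * ‖w i ω‖) ^ 2 :=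
            mul_le_mul_of_nonneg_left h5 (by positivity)
        _ = _ := by ring
    calc ∫ ω, X i ω ^ 2 ∂μ
        ≤ ∫ ω, (2 * ‖g i‖ / (s : ℝ) ^ 2) ^ 2 * ((w i ω).re ^ 2 + (w i ω).im ^ 2) ∂μ :=
          integral_mono (hLp i).integrable_sq ((hi1.add hi2).const_mul _) hle
      _ = (2 * ‖g i‖ / (s : ℝ) ^ 2) ^ 2 * (s : ℝ) ^ 2 := by
          have h6 : ∫ ω, ((w i ω).re ^ 2 + (w i ω).im ^ 2) ∂μ = (s : ℝ) ^ 2 := by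
            rw [integral_add hi1 hi2, h1, h2]
            push_cast
            ring
          rw [integral_const_mul, h6]
      _ = 2 * (2 * ‖g i‖ ^ 2 / (s : ℝ) ^ 2) := by
          rcases eq_or_ne (s : ℝ) 0 with h0 | h0
          · simp [h0]
          · field_simp
  have hfun : ∀ ω, corr π s g (fun i => w i ω) t = (∑ i ∈ Finset.range t, X i) ω := fun ω => by
    simp [corr, hX]
  simp only [hfun]
  have hS2 : MemLp (∑ i ∈ Finset.range t, X i) 2 μ := memLp_finsetSum' _ fun i _ => hLp i
  have hS1 : Integrable (∑ i ∈ Finset.range t, X i) μ := hS2.integrable (by norm_num)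
  refine ⟨hS1, ?_⟩
  have hindX : Pairwise fun i j => X i ⟂ᵢ[μ] X j := fun i j hij =>
    (hind hij).comp (φ := fun z => 2 * π ((starRingEnd ℂ) (g i) * z) / (s : ℝ) ^ 2)
      (ψ := fun z => 2 * π ((starRingEnd ℂ) (g j) * z) / (s : ℝ) ^ 2)
      (((hpart.comp (measurable_id.const_mul _)).const_mul 2).div_const _)
      (((hpart.comp (measurable_id.const_mul _)).const_mul 2).div_const _)
  have hV : Var[∑ i ∈ Finset.range t, X i; μ] ≤ 2 * info s g t := by
    rw [IndepFun.variance_sum (fun i _ => hLp i) fun i _ j _ hij => hindX hij, info,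
      Finset.mul_sum]
    exact Finset.sum_le_sum fun i _ => hvar i
  have hS0 : ∫ ω, (∑ i ∈ Finset.range t, X i) ω ∂μ = 0 := by
    simp only [Finset.sum_apply]
    rw [integral_finsetSum _ fun i _ => (hLp i).integrable (by norm_num)]
    exact Finset.sum_eq_zero fun i _ => hmean i
  rw [variance_of_integral_eq_zero hS2.aemeasurable hS0] at hV
  refine Real.le_sqrt_of_sq_le ?_
  refine le_trans ?_ hV
  -- the variance of the absolute value is nonnegative
  have h7 := variance_eq_sub hS2.abs
  have h8 := variance_nonneg |∑ i ∈ Finset.range t, X i| μ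
  rw [h7] at h8
  simp only [Pi.pow_apply, Pi.abs_apply, sq_abs] at h8
  simpa using h8

end Noise
/-! ### The estimate as a function of the observed gains -/

section ObservedGains

variable {K : ℕ} {π : ℂ → ℝ}

lemma lastSample_congr {U U' : ℕ → ℝ} (e : ℝ) {t : ℕ} (h : ∀ i ≤ t, U i = U' i) :
    lastSample U e t = lastSample U' e t := by
  induction t with
  | zero => rfl
  | succ t ih =>
    have ih' := ih fun i hi => h i (hi.trans (Nat.le_succ t))
    simp only [lastSample]
    rw [ih', h (t + 1) le_rfl, h _ ((lastSample_le t).trans (Nat.le_succ t))]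

lemma recovered_congr {U U' : ℕ → ℝ} (e θ : ℝ) (r : ℕ) {t : ℕ} (h : ∀ i ≤ t, U i = U' i) :
    recovered U e θ r t = recovered U' e θ r t := by
  refine Finset.sum_congr rfl fun i hi => ?_
  have hi' : i + 1 ≤ t := Finset.mem_range.1 hi
  rw [lastSample_congr e fun j hj => h j (by omega), h (i + 1) hi',
    h _ ((lastSample_le i).trans (by omega))]

/-- The estimate as a function of the observed gains (which include the stopping time) and the
noise. -/
noncomputable def estimateAt (D : Design K) (π : ℂ → ℝ) (σ : Fin K → ℝ) (x : ℂ)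
    (G : ℕ∞ × (Fin K → ℕ → ℂ)) (w : Fin K → ℕ → ℂ) : ℝ :=
  (∑ k, midRiser (-(G.1.toNat * D.φ k)) (G.1.toNat * D.φ k) (D.R k)
    (corr π (σ k) (G.2 k) (fun i => x * G.2 k i + w k i) G.1.toNat)) /
    fusedInfo D σ G.2 G.1.toNat

lemma estimateAt_observedGains (D : Design K) (π : ℂ → ℝ) (σ : Fin K → ℝ) (x : ℂ)
    (g w : Fin K → ℕ → ℂ) :
    estimateAt D π σ x (observedGains D σ g) w =
      estimate D π σ g (fun k i => x * g k i + w k i) := by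
  have hobs : ∀ k, ∀ i < (stopTime D σ g).toNat, (observedGains D σ g).2 k i = g k i := by
    intro k i hi
    have h2 : ((i + 1 : ℕ) : ℕ∞) ≤ stopTime D σ g :=
      (Nat.cast_le.2 (Nat.succ_le_of_lt hi)).trans (ENat.natCast_toNat_le_self _)
    exact if_pos h2
  unfold estimateAt estimate
  change (∑ k, midRiser (-((stopTime D σ g).toNat * D.φ k)) ((stopTime D σ g).toNat * D.φ k) _
    (corr π (σ k) ((observedGains D σ g).2 k)
    (fun i => x * (observedGains D σ g).2 k i + w k i) (stopTime D σ g).toNat)) /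
    fusedInfo D σ (observedGains D σ g).2 (stopTime D σ g).toNat = _
  generalize (observedGains D σ g).2 = g' at hobs
  generalize (stopTime D σ g).toNat = T at hobs
  have h1 : ∀ k, corr π (σ k) (g' k) (fun i => x * g' k i + w k i) T =
      corr π (σ k) (g k) (fun i => x * g k i + w k i) T := fun k =>
    Finset.sum_congr rfl fun i hi => by simp only [hobs k i (Finset.mem_range.1 hi)]
  have h2 : fusedInfo D σ g' T = fusedInfo D σ g T := by
    refine Finset.sum_congr rfl fun k _ => recovered_congr _ _ _ fun t ht => ?_
    exact Finset.sum_congr rfl fun i hi => by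
      rw [hobs k i ((Finset.mem_range.1 hi).trans_le ht)]
  simp only [h1, h2]

lemma measurable_of_countable_fst_fst {α β γ : Type*} [MeasurableSpace α] [MeasurableSpace β]
    [MeasurableSpace γ] [Countable α] [MeasurableSingletonClass α] {f : (α × β) × γ → ℝ}
    (hf : ∀ a, Measurable fun q : β × γ => f ((a, q.1), q.2)) : Measurable f :=
  (measurable_from_prod_countable_right (f := fun q : α × (β × γ) => f ((q.1, q.2.1), q.2.2))
    hf).comp MeasurableEquiv.prodAssoc.measurable

lemma measurable_estimateAt (hπ : π = Complex.re ∨ π = Complex.im) (D : Design K)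
    (σ : Fin K → ℝ) (x : ℂ) :
    Measurable fun p : (ℕ∞ × (Fin K → ℕ → ℂ)) × (Fin K → ℕ → ℂ) =>
      estimateAt D π σ x p.1 p.2 := by
  have hpart := measurable_part hπ
  refine measurable_of_countable_fst_fst fun T => ?_
  have hfused := measurable_fusedInfo D σ T.toNat
  have hden : Measurable fun p : (Fin K → ℕ → ℂ) × (Fin K → ℕ → ℂ) =>
    fusedInfo D σ p.1 T.toNat := by fun_prop
  have hcorr : ∀ k, Measurable fun p : (Fin K → ℕ → ℂ) × (Fin K → ℕ → ℂ) =>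
      corr π (σ k) (p.1 k) (fun i => x * p.1 k i + p.2 k i) T.toNat := by
    intro k
    unfold corr
    have hc : Measurable (starRingEnd ℂ) := Complex.continuous_conj.measurable
    fun_prop
  have hQ : ∀ k, Measurable fun p : (Fin K → ℕ → ℂ) × (Fin K → ℕ → ℂ) =>
      midRiser (-(T.toNat * D.φ k)) (T.toNat * D.φ k) (D.R k)
        (corr π (σ k) (p.1 k) (fun i => x * p.1 k i + p.2 k i) T.toNat) :=
    fun k => (measurable_midRiser _ _ _).comp (hcorr k)
  exact (Finset.measurable_sum _ fun k _ => hQ k).div hden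

end ObservedGains

/-! ### Pointwise error bound -/

section Error

variable {K : ℕ} {π : ℂ → ℝ}

/-- The quantized values are bounded by the quantization range. -/
lemma abs_estimate_le {D : Design K} (hφ : ∀ k, 0 < D.φ k) {σ : Fin K → ℝ}
    {g y : Fin K → ℕ → ℂ} (htarget : 0 < D.target) (htop : stopTime D σ g ≠ ⊤) :
    |estimate D π σ g y| ≤ (stopTime D σ g).toNat * ((∑ k, D.φ k) / D.target) := by
  obtain ⟨-, hle⟩ := stopTime_spec htop
  unfold estimate
  rw [abs_div, abs_of_pos (htarget.trans_le hle), ← mul_div_assoc, Finset.mul_sum]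
  refine div_le_div₀ (Finset.sum_nonneg fun k _ => mul_nonneg (Nat.cast_nonneg _) (hφ k).le)
    ((Finset.abs_sum_le_sum_abs _ _).trans (Finset.sum_le_sum fun k _ => ?_)) htarget hle
  have h0 : 0 ≤ ((stopTime D σ g).toNat : ℝ) * D.φ k := mul_nonneg (Nat.cast_nonneg _) (hφ k).le
  exact abs_le.2 (midRiser_mem_Icc (by linarith) _ _)

/-- The error is due to the quantization of the correlator outputs, to the noise, to the deviation
of the information from its mean (this is where values outside of the quantization range come from,
since the range is wide enough for the mean), and to the overshoots that are lost. -/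
lemma abs_estimate_sub_le (hπ : π = Complex.re ∨ π = Complex.im) {D : Design K}
    (hφ : ∀ k, 0 < D.φ k) {σ m : Fin K → ℝ} (x : ℂ) (hm0 : ∀ k, 0 ≤ m k)
    (hm : ∀ k, |π x| * m k ≤ D.φ k)
    {g w : Fin K → ℕ → ℂ} (htarget : 0 < D.target) (htop : stopTime D σ g ≠ ⊤)
    {T : ℕ} (hT : T = (stopTime D σ g).toNat) :
    |estimate D π σ g (fun k i => x * g k i + w k i) - π x| ≤
      (∑ k, (T * D.φ k / 2 ^ D.R k + 2 * |corr π (σ k) (g k) (w k) T| +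
        2 * |π x| * |info (σ k) (g k) T - T * m k|) +
        |π x| * |T * (∑ k, m k) - fusedInfo D σ g T|) / fusedInfo D σ g T := by
  obtain ⟨hone, hle⟩ := stopTime_spec htop
  rw [← hT] at hone hle
  have hF : 0 < fusedInfo D σ g T := htarget.trans_le hle
  have hTpos : (0 : ℝ) < T := by exact_mod_cast hone
  unfold estimate
  simp only [← hT]
  rw [div_sub' hF.ne', abs_div, abs_of_pos hF]
  refine div_le_div_of_nonneg_right ?_ hF.le
  set Q : Fin K → ℝ := fun k => midRiser (-(T * D.φ k)) (T * D.φ k) (D.R k)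
    (corr π (σ k) (g k) (fun i => x * g k i + w k i) T) with hQ
  have hsplit : ∑ k, Q k - fusedInfo D σ g T * π x =
      ∑ k, (Q k - T * m k * π x) + π x * (T * (∑ k, m k) - fusedInfo D σ g T) := by
    rw [Finset.sum_sub_distrib, Finset.mul_sum, ← Finset.sum_mul]
    ring
  rw [hsplit]
  refine (abs_add_le _ _).trans (add_le_add ?_ (abs_mul _ _).le)
  refine (Finset.abs_sum_le_sum_abs _ _).trans (Finset.sum_le_sum fun k _ => ?_)
  have hq := abs_midRiser_sub_le (mul_pos hTpos (hφ k)) (D.R k)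
    (corr π (σ k) (g k) (fun i => x * g k i + w k i) T)
  rw [corr_add hπ] at hq
  simp only [hQ, corr_add hπ]
  generalize midRiser (-(T * D.φ k)) (T * D.φ k) (D.R k)
    (π x * info (σ k) (g k) T + corr π (σ k) (g k) (w k) T) = q at *
  generalize corr π (σ k) (g k) (w k) T = N at *
  generalize info (σ k) (g k) T = U at *
  have hdev : |π x * U + N - T * m k * π x| ≤ |N| + |π x| * |U - T * m k| := by
    have : π x * U + N - T * m k * π x = N + π x * (U - T * m k) := by ring
    rw [this]
    exact (abs_add_le _ _).trans (by rw [abs_mul])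
  have hrange : |T * m k * π x| ≤ T * D.φ k := by
    rw [abs_mul, abs_mul, abs_of_pos hTpos, abs_of_nonneg (hm0 k)]
    nlinarith [hm k]
  have hclip : max 0 (|π x * U + N| - T * D.φ k) ≤ |N| + |π x| * |U - T * m k| := by
    refine max_le (by positivity) ?_
    have := abs_sub_abs_le_abs_sub (π x * U + N) (T * m k * π x)
    linarith
  have htri := abs_sub_le q (π x * U + N) (T * m k * π x)
  linarith

end Error

/-! ### The error averaged over the noise -/

section MeanError

variable {K : ℕ} {π : ℂ → ℝ} {e : Fin K → ℝ → ℝ} {θ φ : Fin K → ℝ} {rU : ℝ → ℕ}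
  {R : Fin K → ℝ → ℕ} {Ω : Type*} [MeasurableSpace Ω] {μ : Measure Ω} [IsProbabilityMeasure μ]
  {σ : Fin K → ℝ≥0} {w : Fin K → ℕ → Ω → ℂ}

lemma measurable_estimate_noise (hπ : π = Complex.re ∨ π = Complex.im) (D : Design K)
    (σ : Fin K → ℝ) (x : ℂ) (g : Fin K → ℕ → ℂ) (hw : ∀ k i, Measurable (w k i)) :
    Measurable fun ω => estimate D π σ g (fun k i => x * g k i + w k i ω) := by
  have hw' : Measurable fun ω => fun k i => w k i ω :=
    measurable_pi_lambda _ fun k => measurable_pi_lambda _ fun i => hw k i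
  have heq : (fun ω => estimate D π σ g (fun k i => x * g k i + w k i ω)) =
      fun ω => estimateAt D π σ x (observedGains D σ g) (fun k i => w k i ω) :=
    funext fun ω => (estimateAt_observedGains D π σ x g fun k i => w k i ω).symm
  rw [heq]
  generalize observedGains D σ g = G
  have hG : Measurable fun ω => (G, fun k i => w k i ω) := measurable_const.prodMk hw'
  have hm := measurable_estimateAt hπ D σ x
  -- otherwise unification would unfold the definition to recognize the composition
  generalize estimateAt D π σ x = f at *
  exact hm.comp hG

lemma integrable_estimate_noise (hπ : π = Complex.re ∨ π = Complex.im) {D : Design K}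
    (hφ : ∀ k, 0 < D.φ k) {σ : Fin K → ℝ} (x : ℂ) {g : Fin K → ℕ → ℂ}
    (hw : ∀ k i, Measurable (w k i)) (htarget : 0 < D.target) (htop : stopTime D σ g ≠ ⊤) :
    Integrable (fun ω => estimate D π σ g (fun k i => x * g k i + w k i ω)) μ :=
  Integrable.of_bound (measurable_estimate_noise hπ D σ x g hw).aestronglyMeasurable _
    (ae_of_all _ fun _ => by
      rw [Real.norm_eq_abs]
      exact abs_estimate_le hφ htarget htop)

/-- For fixed gains, averaging over the noise leaves an error governed by the gains alone. -/
lemma integral_abs_estimate_sub_le (hπ : π = Complex.re ∨ π = Complex.im) {D : Design K}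
    (hφ : ∀ k, 0 < D.φ k) {m : Fin K → ℝ} (x : ℂ) (hm0 : ∀ k, 0 ≤ m k)
    (hm : ∀ k, |π x| * m k ≤ D.φ k) {g : Fin K → ℕ → ℂ} (hw : ∀ k i, Measurable (w k i))
    (hlaw : ∀ k i, μ.map (w k i) = complexGaussian (σ k ^ 2))
    (hind : ∀ k, Pairwise fun i j => w k i ⟂ᵢ[μ] w k j)
    (htarget : 0 < D.target) (htop : stopTime D (fun k => σ k) g ≠ ⊤)
    {T : ℕ} (hT : T = (stopTime D (fun k => σ k) g).toNat) :
    ∫ ω, |estimate D π (fun k => σ k) g (fun k i => x * g k i + w k i ω) - π x| ∂μ ≤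
      (∑ k, (T * D.φ k / 2 ^ D.R k + 2 * √(2 * info (σ k) (g k) T) +
        2 * |π x| * |info (σ k) (g k) T - T * m k|) +
        |π x| * |T * (∑ k, m k) - fusedInfo D (fun k => σ k) g T|) /
        fusedInfo D (fun k => σ k) g T := by
  have hN := fun k => integral_abs_corr_noise_le hπ (hw k) (hlaw k) (hind k) (g k) T
  have hF : 0 < fusedInfo D (fun k => σ k) g T :=
    htarget.trans_le (hT ▸ (stopTime_spec htop).2)
  have hterm : ∀ k, Integrable (fun ω => T * D.φ k / 2 ^ D.R k +
      2 * |corr π (σ k) (g k) (fun i => w k i ω) T| +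
      2 * |π x| * |info (σ k) (g k) T - T * m k|) μ := fun k =>
    ((integrable_const _).add ((hN k).1.abs.const_mul 2)).add (integrable_const _)
  have hsum : Integrable (fun ω => ∑ k, (T * D.φ k / 2 ^ D.R k +
      2 * |corr π (σ k) (g k) (fun i => w k i ω) T| +
      2 * |π x| * |info (σ k) (g k) T - T * m k|)) μ :=
    integrable_finsetSum _ fun k _ => hterm k
  refine (integral_mono ((integrable_estimate_noise hπ hφ x hw htarget htop).sub
    (integrable_const _)).abs ((hsum.add (integrable_const _)).div_const _)
    fun ω => abs_estimate_sub_le hπ hφ x hm0 hm (w := fun k i => w k i ω) htarget htop hT).trans ?_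
  rw [integral_div]
  refine div_le_div_of_nonneg_right ?_ hF.le
  simp only [Pi.add_apply]
  rw [integral_add hsum (integrable_const _), integral_finsetSum _ fun k _ => hterm k]
  simp only [integral_const, probReal_univ, one_smul]
  refine add_le_add_left (Finset.sum_le_sum fun k _ => ?_) _
  have h1 : Integrable (fun ω => T * D.φ k / 2 ^ D.R k +
      2 * |corr π (σ k) (g k) (fun i => w k i ω) T|) μ :=
    (integrable_const _).add ((hN k).1.abs.const_mul 2)
  rw [integral_add h1 (integrable_const _),
    integral_add (integrable_const _) ((hN k).1.abs.const_mul 2), integral_const_mul]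
  simp only [integral_const, probReal_univ, one_smul]
  linarith [(hN k).2]

/-- For regular gains, each contribution to the averaged error vanishes relative to `T`, which is
the order of the recovered information. -/
theorem RegularGains.tendsto_integral_abs_estimate_sub
    (hπ : π = Complex.re ∨ π = Complex.im) {m : Fin K → ℝ} (x : ℂ) (hK : 0 < K)
    (hmpos : ∀ k, 0 < m k) (hm : ∀ k, |π x| * m k ≤ φ k) (hw : ∀ k i, Measurable (w k i))
    (hlaw : ∀ k i, μ.map (w k i) = complexGaussian (σ k ^ 2))
    (hind : ∀ k, Pairwise fun i j => w k i ⟂ᵢ[μ] w k j)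
    (hθ : ∀ k, 0 < θ k) (hφ : ∀ k, 0 < φ k) (hR : ∀ k, Tendsto (R k) atTop atTop)
    (he : ∀ k, Tendsto (e k) atTop atTop) (he' : ∀ k, (e k) =o[atTop] (fun I : ℝ => I))
    {g : Fin K → ℕ → ℂ} (hg : RegularGains (fun k => σ k) m g) :
    Tendsto (fun I => ∫ ω, |estimate (scheme e θ φ rU R I) π (fun k => σ k) g
      (fun k i => x * g k i + w k i ω) - π x| ∂μ) atTop (𝓝 0) := by
  have hT := hg.tendsto_stopTime (φ := φ) (rU := rU) (R := R) hmpos hK hθ he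
  have hF := hg.tendsto_fusedInfo_div (φ := φ) (rU := rU) (R := R) hmpos hK hθ he he'
  have htop := hg.eventually_stopTime_ne_top (φ := φ) (rU := rU) (R := R) hmpos hK hθ he
  set T : ℝ → ℕ := fun I => (stopTime (scheme e θ φ rU R I) (fun k => σ k) g).toNat with hTdef
  set F : ℝ → ℝ := fun I => fusedInfo (scheme e θ φ rU R I) (fun k => σ k) g (T I) with hFdef
  have hmsum : 0 < ∑ k, m k :=
    Finset.sum_pos (fun k _ => hmpos k) ⟨⟨0, hK⟩, Finset.mem_univ _⟩
  have hTr : Tendsto (fun I => (T I : ℝ)) atTop atTop := tendsto_natCast_atTop_atTop.comp hT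
  have hU : ∀ k, Tendsto (fun I => info (σ k) (g k) (T I) / (T I : ℝ)) atTop (𝓝 (m k)) :=
    fun k => (hg k).1.comp hT
  have hquant : ∀ k, Tendsto (fun I => φ k / 2 ^ R k I) atTop (𝓝 0) := fun k => by
    have h2 : Tendsto (fun I => (2 : ℝ) ^ R k I) atTop atTop :=
      (tendsto_pow_atTop_atTop_of_one_lt one_lt_two).comp (hR k)
    exact h2.const_div_atTop _
  have hnoise : ∀ k, Tendsto
      (fun I => 2 * √(2 * (info (σ k) (g k) (T I) / (T I : ℝ)) / (T I : ℝ))) atTop (𝓝 0) := by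
    intro k
    have h1 := (((hU k).const_mul 2).div_atTop hTr).sqrt.const_mul 2
    simpa using h1
  have hdev : ∀ k, Tendsto (fun I => 2 * |π x| * |info (σ k) (g k) (T I) / (T I : ℝ) - m k|)
      atTop (𝓝 0) := by
    intro k
    have h1 := ((hU k).sub_const (m k)).abs.const_mul (2 * |π x|)
    simpa using h1
  have hlost : Tendsto (fun I => |π x| * |∑ k, m k - F I / T I|) atTop (𝓝 0) := by
    have h1 := (hF.const_sub (∑ k, m k)).abs.const_mul |π x|
    simpa using h1
  have hbound : Tendsto (fun I => (∑ k, (φ k / 2 ^ R k I +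
      2 * √(2 * (info (σ k) (g k) (T I) / (T I : ℝ)) / (T I : ℝ)) +
      2 * |π x| * |info (σ k) (g k) (T I) / (T I : ℝ) - m k|) +
      |π x| * |∑ k, m k - F I / T I|) / (F I / T I)) atTop (𝓝 0) := by
    have h1 := ((tendsto_finsetSum Finset.univ fun k _ =>
      ((hquant k).add (hnoise k)).add (hdev k)).add hlost).div hF hmsum.ne'
    simp only [add_zero, Finset.sum_const_zero, zero_div] at h1
    exact h1
  refine squeeze_zero' (Eventually.of_forall fun I => integral_nonneg fun ω => abs_nonneg _) ?_
    hbound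
  filter_upwards [htop, eventually_gt_atTop 0, hT.eventually_gt_atTop 0] with I h1 h2 h3
  have hTpos : (0 : ℝ) < T I := by exact_mod_cast h3
  refine (integral_abs_estimate_sub_le hπ (D := scheme e θ φ rU R I) hφ x
    (fun k => (hmpos k).le) hm hw hlaw hind h2 h1 (T := T I) rfl).trans_eq ?_
  rw [← div_div_div_cancel_right₀ hTpos.ne']
  change _ / (F I / T I) = _ / (F I / T I)
  congr 1
  rw [add_div, Finset.sum_div]
  congr 1
  · refine Finset.sum_congr rfl fun k _ => ?_
    have h4 : info (σ k) (g k) (T I) / (T I : ℝ) - m k =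
        (info (σ k) (g k) (T I) - T I * m k) / T I := by field_simp
    have h5 : √(2 * (info (σ k) (g k) (T I) / (T I : ℝ)) / (T I : ℝ)) =
        √(2 * info (σ k) (g k) (T I)) / T I := by
      have h6 : 2 * (info (σ k) (g k) (T I) / (T I : ℝ)) / (T I : ℝ) =
        2 * info (σ k) (g k) (T I) / (T I : ℝ) ^ 2 := by field_simp
      rw [h6, Real.sqrt_div' _ (by positivity), Real.sqrt_sq hTpos.le]
    rw [h4, h5, abs_div, abs_of_pos hTpos]
    simp only [scheme]
    field_simp
  · have h4 : ∑ k, m k - F I / T I = (T I * ∑ k, m k - F I) / T I := by field_simp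
    rw [h4, abs_div, abs_of_pos hTpos, mul_div_assoc]

end MeanError

/-! ### Law of large numbers for the gains and mean of the stopping time -/

section Gains

variable {Ω : Type*} [MeasurableSpace Ω] {μ : Measure Ω}

/-- Strong law of large numbers, for the variables and for their truncations. -/
lemma ae_tendsto_average_and_truncated {X : ℕ → Ω → ℝ} (hX : ∀ i, Measurable (X i))
    (h0 : ∀ i ω, 0 ≤ X i ω) (hint : Integrable (X 0) μ)
    (hind : Pairwise fun i j => X i ⟂ᵢ[μ] X j) (hident : ∀ i, IdentDistrib (X i) (X 0) μ μ) :
    ∀ᵐ ω ∂μ, Tendsto (fun t : ℕ => (∑ i ∈ Finset.range t, X i ω) / t) atTop (𝓝 μ[X 0]) ∧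
      ∀ a < μ[X 0], ∃ M : ℝ, 0 ≤ M ∧
        ∀ᶠ t : ℕ in atTop, a * t ≤ ∑ i ∈ Finset.range t, min (X i ω) M := by
  have htrunc : ∀ᵐ ω ∂μ, ∀ M : ℕ, Tendsto
      (fun t : ℕ => (∑ i ∈ Finset.range t, min (X i ω) M) / t) atTop
      (𝓝 (∫ ω, min (X 0 ω) M ∂μ)) := by
    refine ae_all_iff.2 fun M => ?_
    have hmin : Measurable fun y : ℝ => min y M := measurable_id.min measurable_const
    refine strong_law_ae_real (fun i ω => min (X i ω) M) ?_ ?_ ?_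
    · exact hint.mono' (hmin.comp (hX 0)).aestronglyMeasurable (ae_of_all _ fun ω => by
        rw [Real.norm_eq_abs, abs_of_nonneg (le_min (h0 0 ω) M.cast_nonneg)]
        exact min_le_left _ _)
    · exact fun i j hij => (hind hij).comp hmin hmin
    · exact fun i => (hident i).comp hmin
  have hlim : Tendsto (fun M : ℕ => ∫ ω, min (X 0 ω) M ∂μ) atTop (𝓝 μ[X 0]) := by
    refine tendsto_integral_of_dominated_convergence (X 0)
      (fun M => ((hX 0).min measurable_const).aestronglyMeasurable) hint
      (fun M => ae_of_all _ fun ω => ?_) (ae_of_all _ fun ω => ?_)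
    · rw [Real.norm_eq_abs, abs_of_nonneg (le_min (h0 0 ω) M.cast_nonneg)]
      exact min_le_left _ _
    · refine tendsto_const_nhds.congr' ?_
      filter_upwards [tendsto_natCast_atTop_atTop.eventually_ge_atTop (X 0 ω)] with M hM
      exact (min_eq_left hM).symm
  filter_upwards [strong_law_ae_real X hint hind hident, htrunc] with ω h1 h2
  refine ⟨h1, fun a ha => ?_⟩
  obtain ⟨M, hM⟩ := (hlim.eventually_const_lt ha).exists
  refine ⟨M, M.cast_nonneg, ?_⟩
  filter_upwards [(h2 M).eventually_const_lt hM, eventually_gt_atTop 0] with t h3 h4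
  exact ((lt_div_iff₀ (by exact_mod_cast h4)).1 h3).le

lemma measurable_two_mul_norm_sq_div (s : ℝ) : Measurable fun z : ℂ => 2 * ‖z‖ ^ 2 / s ^ 2 := by
  fun_prop

lemma ae_regularGains {K : ℕ} {σ : Fin K → ℝ} {h : Fin K → ℕ → Ω → ℂ}
    (hh : ∀ k i, Measurable (h k i)) (hind : ∀ k, iIndepFun (h k) μ)
    (hident : ∀ k i, IdentDistrib (h k i) (h k 0) μ μ)
    (hsq : ∀ k, Integrable (fun ω => ‖h k 0 ω‖ ^ 2) μ) :
    ∀ᵐ ω ∂μ, RegularGains σ (fun k => ∫ ω, 2 * ‖h k 0 ω‖ ^ 2 / σ k ^ 2 ∂μ)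
      (fun k i => h k i ω) := by
  refine ae_all_iff.2 fun k => ?_
  have hf := measurable_two_mul_norm_sq_div (σ k)
  exact ae_tendsto_average_and_truncated (X := fun i ω => 2 * ‖h k i ω‖ ^ 2 / σ k ^ 2)
    (fun i => hf.comp (hh k i)) (fun i ω => by positivity)
    (((hsq k).const_mul 2).div_const _)
    (fun i j hij => ((hind k).indepFun hij).comp hf hf) (fun i => (hident k i).comp hf)

variable [IsProbabilityMeasure μ]

lemma integral_pos_of_ae_pos {f : Ω → ℝ} (hf : ∀ᵐ ω ∂μ, 0 < f ω) (hint : Integrable f μ) :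
    0 < ∫ ω, f ω ∂μ := by
  have h0 : 0 ≤ᵐ[μ] f := hf.mono fun _ h => h.le
  refine (integral_nonneg_of_ae h0).lt_of_ne fun heq => ?_
  obtain ⟨ω, h1, h2⟩ := (hf.and ((integral_eq_zero_iff_of_nonneg_ae h0 hint).1 heq.symm)).exists
  exact h1.ne' h2

lemma mean_info_pos {s : ℝ} (hs : 0 < s) {X : Ω → ℂ} (hX : ∀ᵐ ω ∂μ, X ω ≠ 0)
    (hsq : Integrable (fun ω => ‖X ω‖ ^ 2) μ) : 0 < ∫ ω, 2 * ‖X ω‖ ^ 2 / s ^ 2 ∂μ := by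
  refine integral_pos_of_ae_pos ?_ ((hsq.const_mul 2).div_const _)
  filter_upwards [hX] with ω hω
  have := norm_pos_iff.2 hω
  positivity

/-- The exponential moment at `-1` of a sum of i.i.d. positive variables decays geometrically. -/
lemma exists_integral_exp_neg_sum_eq {X : ℕ → Ω → ℝ} (hX : ∀ i, Measurable (X i))
    (hpos : ∀ᵐ ω ∂μ, 0 < X 0 ω) (hind : iIndepFun X μ)
    (hident : ∀ i, IdentDistrib (X i) (X 0) μ μ) :
    ∃ ρ : ℝ, 0 ≤ ρ ∧ ρ < 1 ∧ ∀ t : ℕ,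
      ∫ ω, Real.exp (-∑ i ∈ Finset.range t, X i ω) ∂μ = ρ ^ t := by
  refine ⟨mgf (X 0) μ (-1), mgf_nonneg, ?_, fun t => ?_⟩
  · have hint : Integrable (fun ω => Real.exp (-1 * X 0 ω)) μ := by
      refine Integrable.of_bound (C := 1) (by fun_prop) ?_
      filter_upwards [hpos] with ω hω
      rw [Real.norm_eq_abs, Real.abs_exp, Real.exp_le_one_iff]
      linarith
    have h1 : 0 < ∫ ω, (1 - Real.exp (-1 * X 0 ω)) ∂μ := by
      refine integral_pos_of_ae_pos ?_ ((integrable_const 1).sub hint)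
      filter_upwards [hpos] with ω hω
      rw [sub_pos, Real.exp_lt_one_iff]
      linarith
    rw [integral_sub (integrable_const 1) hint] at h1
    simpa [mgf] using h1
  · have h1 := hind.mgf_sum hX (Finset.range t) (t := -1)
    have h2 : ∀ i, mgf (X i) μ (-1) = mgf (X 0) μ (-1) := fun i =>
      congrFun (mgf_congr_identDistrib (hident i)) _
    simp only [h2, Finset.prod_const, Finset.card_range] at h1
    rw [← h1, mgf]
    simp

/-- The stopping time has a finite mean: as long as the scheme runs, the information truncated at
`1` is bounded, and the probability of this decays geometrically. -/
lemma integrable_stopTime {K : ℕ} (hK : 0 < K) {σ : Fin K → ℝ} (hσ : ∀ k, 0 < σ k)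
    {h : Fin K → ℕ → Ω → ℂ} (hh : ∀ k i, Measurable (h k i)) (hind : ∀ k, iIndepFun (h k) μ)
    (hident : ∀ k i, IdentDistrib (h k i) (h k 0) μ μ) (hne : ∀ k i, ∀ᵐ ω ∂μ, h k i ω ≠ 0)
    {D : Design K} (he : ∀ k, 0 < D.e k) (hθ : ∀ k, 0 < D.θ k) (htarget : 0 < D.target) :
    Integrable (fun ω => ((stopTime D σ (fun k i => h k i ω)).toNat : ℝ)) μ := by
  set k : Fin K := ⟨0, hK⟩
  set X : ℕ → Ω → ℝ := fun i ω => min (2 * ‖h k i ω‖ ^ 2 / σ k ^ 2) 1 with hXdef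
  have hf : Measurable fun z : ℂ => min (2 * ‖z‖ ^ 2 / σ k ^ 2) 1 :=
    (measurable_two_mul_norm_sq_div (σ k)).min measurable_const
  have hX : ∀ i, Measurable (X i) := fun i => hf.comp (hh k i)
  obtain ⟨ρ, hρ0, hρ1, hρ⟩ := exists_integral_exp_neg_sum_eq (μ := μ) hX (by
    filter_upwards [hne k 0] with ω hω
    have := hσ k
    have := norm_pos_iff.2 hω
    exact lt_min (by positivity) one_pos) ((hind k).comp (fun _ => _) fun _ => hf)
    (fun i => (hident k i).comp hf)
  set C : ℝ := (1 + 1 / D.e k) * D.target + D.e k with hC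
  have hek := he k
  have hC0 : 0 ≤ C := by positivity
  have hgmeas : Measurable fun ω => fun k i => h k i ω :=
    measurable_pi_lambda _ fun k => measurable_pi_lambda _ fun i => hh k i
  have hTmeas : Measurable fun ω => (stopTime D σ (fun k i => h k i ω)).toNat :=
    (measurable_from_top (f := ENat.toNat)).comp ((measurable_stopTime D σ).comp hgmeas)
  -- while the scheme runs, the truncated information is at most `C`
  have hrun : ∀ ω, ∀ t < (stopTime D σ (fun k i => h k i ω)).toNat,
      ∑ i ∈ Finset.range t, X i ω ≤ C := by
    intro ω t ht
    rcases Nat.eq_zero_or_pos t with rfl | htpos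
    · simpa using hC0
    have hlt : fusedInfo D σ (fun k i => h k i ω) t < D.target := by
      by_contra! hge
      have h1 := ENat.toNat_le_toNat (stopTime_le htpos hge) (ENat.natCast_ne_top t)
      rw [ENat.toNat_natCast] at h1
      omega
    have h2 : recovered (info (σ k) (fun i => h k i ω)) (D.e k) (D.θ k) D.rU t ≤ D.target :=
      (Finset.single_le_sum
        (f := fun k => recovered (info (σ k) (fun i => h k i ω)) (D.e k) (D.θ k) D.rU t)
        (fun k _ => recovered_nonneg (he k) (hθ k).le _ _) (Finset.mem_univ k)).trans hlt.le
    refine (sum_min_le_recovered (he k) (hθ k).le zero_le_one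
      (U := info (σ k) (fun i => h k i ω)) (fun _ => rfl) D.rU t).trans ?_
    rw [hC]
    have : 0 ≤ 1 + 1 / D.e k := by positivity
    linarith [mul_le_mul_of_nonneg_left h2 this]
  have hexpmeas : ∀ t : ℕ, Measurable fun ω => Real.exp (C - ∑ i ∈ Finset.range t, X i ω) :=
    fun t => by fun_prop
  have hpoint : ∀ ω, ‖((stopTime D σ (fun k i => h k i ω)).toNat : ℝ)‖ₑ ≤
      ∑' t : ℕ, ENNReal.ofReal (Real.exp (C - ∑ i ∈ Finset.range t, X i ω)) := by
    intro ω
    refine le_trans ?_ (ENNReal.sum_le_tsum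
      (Finset.range (stopTime D σ (fun k i => h k i ω)).toNat))
    have h1 : ∀ t ∈ Finset.range (stopTime D σ (fun k i => h k i ω)).toNat,
        1 ≤ ENNReal.ofReal (Real.exp (C - ∑ i ∈ Finset.range t, X i ω)) := by
      intro t ht
      rw [ENNReal.one_le_ofReal, Real.one_le_exp_iff]
      linarith [hrun ω t (Finset.mem_range.1 ht)]
    refine le_trans ?_ (Finset.sum_le_sum h1)
    simp [Real.enorm_natCast]
  refine ⟨(measurable_from_top (f := fun n : ℕ => (n : ℝ))).comp hTmeas |>.aestronglyMeasurable, ?_⟩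
  refine lt_of_le_of_lt (lintegral_mono hpoint) ?_
  rw [lintegral_tsum fun t => (hexpmeas t).ennreal_ofReal.aemeasurable]
  have hterm : ∀ t : ℕ, ∫⁻ ω, ENNReal.ofReal (Real.exp (C - ∑ i ∈ Finset.range t, X i ω)) ∂μ =
      ENNReal.ofReal (Real.exp C * ρ ^ t) := by
    intro t
    have hbound : ∀ ω, ‖Real.exp (C - ∑ i ∈ Finset.range t, X i ω)‖ ≤ Real.exp C := by
      intro ω
      rw [Real.norm_eq_abs, Real.abs_exp, Real.exp_le_exp]
      have : 0 ≤ ∑ i ∈ Finset.range t, X i ω :=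
        Finset.sum_nonneg fun i _ => le_min (by positivity) zero_le_one
      linarith
    rw [← ofReal_integral_eq_lintegral_ofReal (Integrable.of_bound
      (hexpmeas t).aestronglyMeasurable _ (ae_of_all _ hbound))
      (ae_of_all _ fun ω => (Real.exp_pos _).le), ← hρ t, ← integral_const_mul]
    simp only [sub_eq_add_neg, Real.exp_add]
  simp only [hterm]
  rw [← ENNReal.ofReal_tsum_of_nonneg (fun t => by positivity)
    ((summable_geometric_of_lt_one hρ0 hρ1).mul_left _)]
  exact ENNReal.ofReal_lt_top

end Gains
end LTsDMLE

/-! ### Conditioning on the observed gains -/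

/-- Conditioning a function of two independent variables on the first one amounts to freezing the
first one and averaging over the second one. -/
lemma condExp_comap_ae_eq_integral_of_indepFun {Ω β γ : Type*} [MeasurableSpace Ω]
    {μ : Measure Ω} [IsProbabilityMeasure μ] [mβ : MeasurableSpace β] [MeasurableSpace γ]
    [StandardBorelSpace γ] [Nonempty γ] {X : Ω → β} {Y : Ω → γ} (hX : Measurable X)
    (hY : Measurable Y) (hXY : X ⟂ᵢ[μ] Y) {f : β × γ → ℝ} (hf : Measurable f)
    (hint : Integrable (fun ω => f (X ω, Y ω)) μ) :
    μ[fun ω => f (X ω, Y ω) | mβ.comap X] =ᵐ[μ] fun ω => ∫ ω', f (X ω, Y ω') ∂μ := by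
  have := Measure.isProbabilityMeasure_map (μ := μ) hY.aemeasurable
  have hκ : condDistrib Y X μ =ᵐ[μ.map X] Kernel.const β (μ.map Y) := by
    refine condDistrib_ae_eq_of_measure_eq_compProd X hY.aemeasurable ?_
    rw [Measure.compProd_const]
    exact (indepFun_iff_map_prod_eq_prod_map_map hX.aemeasurable hY.aemeasurable).1 hXY
  refine (condExp_prod_ae_eq_integral_condDistrib hX hY.aemeasurable hf.stronglyMeasurable
    hint).trans ?_
  filter_upwards [ae_of_ae_map hX.aemeasurable hκ] with ω hω
  rw [hω, Kernel.const_apply]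
  exact integral_map hY.aemeasurable
    (hf.comp measurable_prodMk_left).aestronglyMeasurable

namespace LTsDMLE

section Conditioning

lemma estimator_eq_estimateAt {Ω : Type*} {K : ℕ} {π : ℂ → ℝ} {h w : Fin K → ℕ → Ω → ℂ}
    (D : Design K) (σ : Fin K → ℝ) (x : ℂ) (ω : Ω) :
    estimator D π σ x h w ω =
      estimateAt D π σ x (observedGains D σ fun k i => h k i ω) (fun k i => w k i ω) :=
  (estimateAt_observedGains D π σ x (fun k i => h k i ω) fun k i => w k i ω).symm

variable {Ω : Type*} [MeasurableSpace Ω] {μ : Measure Ω} {K : ℕ} {π : ℂ → ℝ}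
  {h w : Fin K → ℕ → Ω → ℂ}

lemma measurable_observedGains_comp (D : Design K) (σ : Fin K → ℝ)
    (hh : ∀ k i, Measurable (h k i)) :
    Measurable fun ω => observedGains D σ (fun k i => h k i ω) := by
  have hm := measurable_observedGains D σ
  -- otherwise unification would unfold the definition to recognize the composition
  generalize observedGains D σ = f at *
  exact hm.comp (measurable_pi_lambda _ fun k => measurable_pi_lambda _ fun i => hh k i)

lemma measurable_estimator (hπ : π = Complex.re ∨ π = Complex.im) (D : Design K)
    (σ : Fin K → ℝ) (x : ℂ) (hh : ∀ k i, Measurable (h k i)) (hw : ∀ k i, Measurable (w k i)) :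
    Measurable (estimator D π σ x h w) := by
  have heq : estimator D π σ x h w = fun ω =>
      estimateAt D π σ x (observedGains D σ fun k i => h k i ω) (fun k i => w k i ω) :=
    funext fun ω => estimator_eq_estimateAt D σ x ω
  have hw' : Measurable fun ω => fun k i => w k i ω :=
    measurable_pi_lambda _ fun k => measurable_pi_lambda _ fun i => hw k i
  have hG := (measurable_observedGains_comp D σ hh).prodMk hw'
  have hm := measurable_estimateAt hπ D σ x
  rw [heq]
  -- otherwise unification would unfold the definition to recognize the composition
  generalize estimateAt D π σ x = f at *
  exact hm.comp hG

variable [IsProbabilityMeasure μ]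

/-- Conditioning on the observed gains amounts to averaging over the noise, the gains being
fixed. -/
lemma condExp_estimator (hπ : π = Complex.re ∨ π = Complex.im) (D : Design K)
    (σ : Fin K → ℝ) (x : ℂ) (hh : ∀ k i, Measurable (h k i)) (hw : ∀ k i, Measurable (w k i))
    (hhw : IndepFun (fun ω k i => h k i ω) (fun ω k i => w k i ω) μ) {F : ℝ → ℝ}
    (hF : Measurable F) (hint : Integrable (fun ω => F (estimator D π σ x h w ω)) μ) :
    μ[fun ω => F (estimator D π σ x h w ω) | gainAlgebra D σ h] =ᵐ[μ] fun ω =>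
      ∫ ω', F (estimate D π σ (fun k i => h k i ω) fun k i => x * h k i ω + w k i ω') ∂μ := by
  have hw' : Measurable fun ω => fun k i => w k i ω :=
    measurable_pi_lambda _ fun k => measurable_pi_lambda _ fun i => hw k i
  have hindep : IndepFun (fun ω => observedGains D σ fun k i => h k i ω)
      (fun ω k i => w k i ω) μ := hhw.comp (measurable_observedGains D σ) measurable_id
  have hm : Measurable fun p : (ℕ∞ × (Fin K → ℕ → ℂ)) × (Fin K → ℕ → ℂ) =>
    F (estimateAt D π σ x p.1 p.2) := hF.comp (measurable_estimateAt hπ D σ x)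
  simp only [estimator_eq_estimateAt] at hint ⊢
  have := condExp_comap_ae_eq_integral_of_indepFun (measurable_observedGains_comp D σ hh) hw'
    hindep hm hint
  simpa only [estimateAt_observedGains] using this

end Conditioning
end LTsDMLE

/-! ### The theorem -/

/-- `h k i` and `w k i` are the channel gain and the noise of sensor `k` at time `i + 1`; `I` is the
target information, `π` is the real or the imaginary part, the one that is being estimated. -/
theorem theorem4 {Ω : Type*} [MeasurableSpace Ω] (μ : Measure Ω) [IsProbabilityMeasure μ]
    (K : ℕ) (hK : 0 < K) (σ : Fin K → ℝ≥0) (hσ : ∀ k, 0 < σ k)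
    (x : ℂ) (hA1 : x.re ≠ 0 ∧ x.im ≠ 0)
    (h w : Fin K → ℕ → Ω → ℂ)
    (hh_meas : ∀ k i, Measurable (h k i)) (hw_meas : ∀ k i, Measurable (w k i))
    -- the gains of each sensor are i.i.d. over time, nonzero, and have finite mean power
    (hh_indep : ∀ k, iIndepFun (h k) μ)
    (hh_ident : ∀ k i, IdentDistrib (h k i) (h k 0) μ μ)
    (hA2 : ∀ k i, ∀ᵐ ω ∂μ, h k i ω ≠ 0)
    (hh_sq : ∀ k, Integrable (fun ω => ‖h k 0 ω‖ ^ 2) μ)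
    -- the noise is Gaussian, independent over time and sensors, and independent of the gains
    (hw_law : ∀ k i, μ.map (w k i) = complexGaussian (σ k ^ 2))
    (hw_indep : iIndepFun (fun p : Fin K × ℕ => w p.1 p.2) μ)
    (hhw_indep : IndepFun (fun ω k i => h k i ω) (fun ω k i => w k i ω) μ)
    (π : ℂ → ℝ) (hπ : π = Complex.re ∨ π = Complex.im)
    -- the design parameters, as functions of the target `I` where they may depend on it
    (e : Fin K → ℝ → ℝ) (θ φ : Fin K → ℝ) (rU : ℝ → ℕ) (R : Fin K → ℝ → ℕ)
    (hθ : ∀ k, 0 < θ k) (hφ_pos : ∀ k, 0 < φ k)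
    (hφ : ∀ k, |π x| * ∫ ω, 2 * ‖h k 0 ω‖ ^ 2 / (σ k : ℝ) ^ 2 ∂μ ≤ φ k)
    (D : ℝ → LTsDMLE.Design K)
    (hD : D = fun I => ⟨I, fun k => e k I, θ, φ, rU I, fun k => R k I⟩)
    (hR : ∀ k, Tendsto (R k) atTop atTop)
    (he : ∀ k, Tendsto (e k) atTop atTop)
    (he' : ∀ k, (e k) =o[atTop] (fun I : ℝ => I)) :
    -- the scheme stops almost surely and its estimate is integrable
    (∀ᶠ I in atTop,
      (∀ᵐ ω ∂μ, LTsDMLE.stopTime (D I) (fun k => σ k) (fun k i => h k i ω) ≠ ⊤) ∧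
      LTsDMLE.gainAlgebra (D I) (fun k => σ k) h ≤ ‹MeasurableSpace Ω› ∧
      Integrable (LTsDMLE.estimator (D I) π (fun k => σ k) x h w) μ) ∧
    -- asymptotic unbiasedness, conditionally on the observed channel gains
    (∀ I : ℕ → ℝ, Tendsto I atTop atTop → ∀ᵐ ω ∂μ,
      Tendsto (fun m =>
        (μ[fun ω' => LTsDMLE.estimator (D (I m)) π (fun k => σ k) x h w ω' - π x |
          LTsDMLE.gainAlgebra (D (I m)) (fun k => σ k) h]) ω) atTop (𝓝 0)) ∧
    -- consistency, conditionally on the observed channel gains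
    (∀ ε : ℝ, 0 < ε → ∀ I : ℕ → ℝ, Tendsto I atTop atTop → ∀ᵐ ω ∂μ,
      Tendsto (fun m =>
        (μ⟦{ω' | ε ≤ |LTsDMLE.estimator (D (I m)) π (fun k => σ k) x h w ω' - π x|} |
          LTsDMLE.gainAlgebra (D (I m)) (fun k => σ k) h⟧) ω) atTop (𝓝 0)) ∧
    -- consistency, unconditionally
    TendstoInMeasure μ (fun I => LTsDMLE.estimator (D I) π (fun k => σ k) x h w) atTop
      (fun _ => π x) := by
  have hhk : ∀ k, Pairwise fun i j => w k i ⟂ᵢ[μ] w k j := fun k i j hij =>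
    hw_indep.indepFun (i := (k, i)) (j := (k, j)) (by simpa using hij)
  have hσ' : ∀ k, (0 : ℝ) < σ k := fun k => by exact_mod_cast hσ k
  have hmpos : ∀ k, 0 < ∫ ω, 2 * ‖h k 0 ω‖ ^ 2 / (σ k : ℝ) ^ 2 ∂μ := fun k =>
    LTsDMLE.mean_info_pos (hσ' k) (hA2 k 0) (hh_sq k)
  obtain rfl : D = LTsDMLE.scheme e θ φ rU R := hD
  have hreg := LTsDMLE.ae_regularGains (σ := fun k => (σ k : ℝ)) hh_meas hh_indep hh_ident hh_sq
  -- the error averaged over the noise, for the observed gains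
  have hmean : ∀ᵐ ω ∂μ, Tendsto (fun I => ∫ ω', |LTsDMLE.estimate
      (LTsDMLE.scheme e θ φ rU R I) π (fun k => σ k) (fun k i => h k i ω)
      (fun k i => x * h k i ω + w k i ω') - π x| ∂μ) atTop (𝓝 0) := by
    filter_upwards [hreg] with ω hω
    exact hω.tendsto_integral_abs_estimate_sub hπ x hK hmpos hφ hw_meas hw_law hhk hθ hφ_pos hR
      he he'
  have hmeas : ∀ I, Measurable (LTsDMLE.estimator (LTsDMLE.scheme e θ φ rU R I) π
      (fun k => σ k) x h w) := fun I => LTsDMLE.measurable_estimator hπ _ _ x hh_meas hw_meas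
  have halg : ∀ I, LTsDMLE.gainAlgebra (LTsDMLE.scheme e θ φ rU R I) (fun k => σ k) h ≤
      ‹MeasurableSpace Ω› := fun I =>
    (LTsDMLE.measurable_observedGains_comp _ _ hh_meas).comap_le
  have hfinite : ∀ᶠ I in atTop, ∀ᵐ ω ∂μ, LTsDMLE.stopTime (LTsDMLE.scheme e θ φ rU R I)
      (fun k => σ k) (fun k i => h k i ω) ≠ ⊤ := by
    filter_upwards [eventually_all.2 fun k => (he k).eventually_gt_atTop 0] with I hI
    filter_upwards [hreg] with ω hω
    exact hω.stopTime_ne_top hmpos hK hI hθ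
  have hint : ∀ᶠ I in atTop, Integrable (LTsDMLE.estimator (LTsDMLE.scheme e θ φ rU R I) π
      (fun k => σ k) x h w) μ := by
    filter_upwards [eventually_all.2 fun k => (he k).eventually_gt_atTop 0, hfinite,
      eventually_gt_atTop 0] with I hI hfiniteI hpos
    have hT := LTsDMLE.integrable_stopTime (D := LTsDMLE.scheme e θ φ rU R I) hK hσ' hh_meas
      hh_indep hh_ident hA2 hI hθ hpos
    refine (hT.mul_const ((∑ k, φ k) / I)).mono' (hmeas I).aestronglyMeasurable ?_
    filter_upwards [hfiniteI] with ω hω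
    exact LTsDMLE.abs_estimate_le (D := LTsDMLE.scheme e θ φ rU R I) hφ_pos hpos hω
  have hbias : ∀ I : ℕ → ℝ, Tendsto I atTop atTop → ∀ᵐ ω ∂μ, Tendsto (fun m =>
      (μ[fun ω' => LTsDMLE.estimator (LTsDMLE.scheme e θ φ rU R (I m)) π (fun k => σ k) x h w ω'
        - π x | LTsDMLE.gainAlgebra (LTsDMLE.scheme e θ φ rU R (I m)) (fun k => σ k) h]) ω)
      atTop (𝓝 0) := by
    intro I hI
    have hcond : ∀ᵐ ω ∂μ, ∀ m, Integrable (LTsDMLE.estimator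
        (LTsDMLE.scheme e θ φ rU R (I m)) π (fun k => σ k) x h w) μ → _ :=
      ae_all_iff.2 fun m => Filter.eventually_imp_distrib_left.2 fun hm =>
        LTsDMLE.condExp_estimator hπ (LTsDMLE.scheme e θ φ rU R (I m)) (fun k => σ k) x hh_meas
          hw_meas hhw_indep (F := fun v => v - π x) (measurable_id.sub_const _)
          (hm.sub (integrable_const _))
    filter_upwards [hcond, hmean] with ω h1 h2
    refine squeeze_zero_norm' ?_ (h2.comp hI)
    filter_upwards [hI.eventually hint] with m hm
    rw [h1 m hm]
    exact norm_integral_le_integral_norm _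
  have hcons : ∀ ε : ℝ, 0 < ε → ∀ I : ℕ → ℝ, Tendsto I atTop atTop → ∀ᵐ ω ∂μ,
      Tendsto (fun m => (μ⟦{ω' | ε ≤ |LTsDMLE.estimator (LTsDMLE.scheme e θ φ rU R (I m)) π
        (fun k => σ k) x h w ω' - π x|} |
          LTsDMLE.gainAlgebra (LTsDMLE.scheme e θ φ rU R (I m)) (fun k => σ k) h⟧) ω)
      atTop (𝓝 0) := by
    intro ε hε I hI
    set F : ℝ → ℝ := Set.indicator {v | ε ≤ |v - π x|} (fun _ => 1) with hF
    have hFmeas : Measurable F := measurable_const.indicator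
      (measurableSet_le measurable_const (by fun_prop))
    have hF0 : ∀ v, 0 ≤ F v := fun v => Set.indicator_nonneg (fun _ _ => zero_le_one) v
    have hF1 : ∀ v, F v ≤ 1 := fun v => Set.indicator_le_self' (fun _ _ => zero_le_one) v
    -- Markov's inequality, before averaging over the noise
    have hFle : ∀ v, F v ≤ ε⁻¹ * |v - π x| := by
      intro v
      by_cases hv : ε ≤ |v - π x|
      · rw [hF, Set.indicator_of_mem (by exact hv), inv_mul_eq_div, one_le_div hε]
        exact hv
      · rw [hF, Set.indicator_of_notMem (by exact hv)]
        positivity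
    have hcond : ∀ᵐ ω ∂μ, ∀ m, _ := ae_all_iff.2 fun m =>
        LTsDMLE.condExp_estimator hπ (LTsDMLE.scheme e θ φ rU R (I m)) (fun k => σ k) x hh_meas
          hw_meas hhw_indep hFmeas
          (Integrable.of_bound (hFmeas.comp (hmeas (I m))).aestronglyMeasurable 1
            (ae_of_all _ fun ω => by rw [Real.norm_eq_abs, abs_of_nonneg (hF0 _)]; exact hF1 _))
    filter_upwards [hcond, hmean, hreg] with ω h1 h2 h3
    have h4 : Tendsto _ atTop (𝓝 (ε⁻¹ * 0)) := (h2.comp hI).const_mul ε⁻¹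
    rw [mul_zero] at h4
    refine squeeze_zero' (g := _) ?_ ?_ h4
    · refine Eventually.of_forall fun m => ?_
      change 0 ≤ (μ[fun ω' => F _ | _]) ω
      rw [h1 m]
      exact integral_nonneg fun ω' => hF0 _
    · filter_upwards [hI.eventually (h3.eventually_stopTime_ne_top (φ := φ) (rU := rU) (R := R)
        hmpos hK hθ he), hI.eventually_gt_atTop 0] with m hm hpos
      change (μ[fun ω' => F _ | _]) ω ≤ _
      rw [h1 m, Function.comp_apply, ← integral_const_mul]
      refine integral_mono_of_nonneg (ae_of_all _ fun ω' => hF0 _) ?_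
        (ae_of_all _ fun ω' => hFle _)
      exact (((LTsDMLE.integrable_estimate_noise hπ (D := LTsDMLE.scheme e θ φ rU R (I m))
        hφ_pos x hw_meas hpos hm).sub (integrable_const _)).abs).const_mul _
  refine ⟨hfinite.and (hint.mono fun I hI => ⟨halg I, hI⟩), hbias, hcons, ?_⟩
  refine tendstoInMeasure_iff_measureReal_norm.2 fun ε hε => tendsto_of_seq_tendsto fun I hI => ?_
  have hset : ∀ m, MeasurableSet {ω' | ε ≤ |LTsDMLE.estimator
      (LTsDMLE.scheme e θ φ rU R (I m)) π (fun k => σ k) x h w ω' - π x|} := fun m =>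
    measurableSet_le measurable_const (by have := hmeas (I m); fun_prop)
  -- the probability is the mean of the conditional probability
  have hlim := tendsto_integral_of_dominated_convergence (μ := μ) (f := fun _ => (0 : ℝ))
    (fun _ => 1) (F := fun m ω => (μ⟦{ω' | ε ≤ |LTsDMLE.estimator
      (LTsDMLE.scheme e θ φ rU R (I m)) π (fun k => σ k) x h w ω' - π x|} |
        LTsDMLE.gainAlgebra (LTsDMLE.scheme e θ φ rU R (I m)) (fun k => σ k) h⟧) ω)
    (fun m => integrable_condExp.aestronglyMeasurable) (integrable_const 1)
    (fun m => by
      refine ae_bdd_abs_condExp_of_ae_bdd_abs (R := (1 : ℝ)) (ae_of_all _ fun ω => ?_)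
      rw [abs_of_nonneg (Set.indicator_nonneg (fun _ _ => zero_le_one) ω)]
      exact Set.indicator_le_self' (fun _ _ => zero_le_one) ω)
    (hcons ε hε I hI)
  rw [integral_zero] at hlim
  refine hlim.congr fun m => ?_
  rw [integral_condExp (halg (I m)), integral_indicator (hset m)]
  simp [Real.norm_eq_abs]
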